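/- Let $n\ge 2$ and let $\Omega\subseteq\mathbb R^n$ be open (for instance $\Omega=\mathbb R^n$). Consider the mechanical port-Hamiltonian system with $n-2$ Pfaffian constraints $G_c^\top(q)\dot q=0$ and two inputs, $$\dot q=\nabla_{p_0}\mathcal H_0,\qquad \dot p_0=-\nabla_q\mathcal H_0-D_0\nabla_{p_0}\mathcal H_0+G_0u+G_c\lambda,\qquad \mathcal H_0=\tfrac12p_0^\top M_0^{-1}(q)p_0+\mathcal V(q),\qquad q\in\Omega,$$ where $M_0(q)=M_0^\top(q)>0$, $D_0(p_0,q)=D_0^\top(p_0,q)\ge0$ and $\mathcal V$ are smooth, $G_c(q)\in\mathbb R^{n\times(n-2)}$ has full rank and $[G_0(q)\ G_c(q)]\in\mathbb R^{n\times n}$ has full rank. Let $Q(q)\in\mathbb R^{n\times2}$ be smooth of rank $2$ with $Q^\top G_c=0$. Eliminating the multipliers gives the reduced system with momentum $p\in\mathbb R^2$ and $$M=Q^\top M_0Q,\quad p_0=M_0QM^{-1}p,\quad G=Q^\top G_0,\quad D=Q^\top D_0(p_0,q)Q,\quad C=Q^\top\Big\{\tfrac{\partial^\top}{\partial q}[M_0QM^{-1}p]-\tfrac{\partial}{\partial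 q}[M_0QM^{-1}p]\Big\}Q .$$ Let $f_z:\Omega\to\mathbb R^n$ be a diffeomorphism with $f_z^{-1}(0)=0$, write $z=f_z(q)$, let $M_z,C_z,D_z,G_z,\mathcal V_z$ be $M,C,D,G,\mathcal V$ evaluated at $q=f_z^{-1}(z)$, and $Q_z(z)=\frac{\partial f_z}{\partial q}Q\big|_{q=f_z^{-1}(z)}$. Assume that the system has a chained structure: for all $z\in\mathbb R^n$ and $j=1,\dots,n-2$, (row $j+2$ of $Q_z(z)$) $=z_{j+1}\cdot$ (row $1$ of $Q_z(z)$); that is, $Q_z^\perp Q_z=0$ for the $(n-2)\times n$ matrix $Q_z^\perp(z)$ whose $j$-th row has $-z_{j+1}$ in column $1$, $1$ in column $j+2$ and $0$ elsewhere. Let $f_w:z\mapsto w$, for $z_1\ne0$, be the inverse on $\{w_1\neq0\}$ of the map $z=f_w^{-1}(w)$, $$z_1=w_1,\qquad z_2=w_1w_2+\sum_{i=3}^n\frac{w_1^{i-2}}{(i-2)!}w_i,\qquad z_j=\sum_{i=3}^n\frac{w_1^{i+j-4}}{(i+j-4)!}w_i\quad(3\le j\le n).$$ Let $M_w,C_w,D_w,G_w,\mathcal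 V_w$ be $M_z,C_z,D_z,G_z,\mathcal V_z$ evaluated at $z=f_w^{-1}(w)$, $Q_w=\frac{\partial f_w}{\partial z}Q_z\big|_{z=f_w^{-1}(w)}$ and $\mathcal H_w=\frac12p^\top M_w^{-1}p+\mathcal V_w$. For $w_1\neq 0$ the system in the coordinates $(w,p)$ is $$\dot w=Q_w\nabla_p\mathcal H_w,\qquad \dot p=-Q_w^\top\nabla_w\mathcal H_w+(C_w-D_w)\nabla_p\mathcal H_w+G_wu .$$ Let $\hat D\in\mathbb R^{2\times2}$ be symmetric positive definite, $k>0$, $L=\operatorname{diag}(l_1,\dots,l_n)$ with all $l_i>0$, $e_1$ the first standard basis vector of $\mathbb R^n$, and apply the control law $$u=-G_w^{-1}\Big\{Q_w^\top[Lw-\nabla_w\mathcal V_w]+\Big[\hat D+\frac k{w_1^2}Q_w^\top e_1e_1^\top Q_w\Big]\nabla_p\mathcal H_w\Big\}.$$ Then: 1. For $w_1\ne0$ the closed loop has the form $$\dot w=Q_w\nabla_p\mathcal H_d,\qquad \dot p=-Q_w^\top\nabla_w\mathcal H_d+(C_w-D_d)\nabla_p\mathcal H_d,\qquad(\ast)$$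 with $\mathcal H_d=\frac12p^\top M_w^{-1}p+\frac12w^\top Lw$ and $D_d=D_w+\hat D+\frac k{w_1^2}Q_w^\top e_1e_1^\top Q_w$. 2. For every $t_0$ and every initial condition with $w_1(t_0)\ne0$, the closed loop $(\ast)$ has a solution on $[t_0,\infty)$, and every solution on an interval $[t_0,T)$ with the same initial condition coincides with it there. 3. Every solution of $(\ast)$ on $[t_0,\infty)$ with $w_1(t_0)\neq0$ satisfies $w_1(t)\ne0$ for all $t\ge t_0$, $\lim_{t\to\infty}w_1(t)=0$, and $\lim_{t\to\infty}z(t)=0$ for $z(t)=f_w^{-1}(w(t))$. (Here a solution is a continuous curve $(w,p)$ that satisfies $(\ast)$ at every time at which $w_1\ne0$.) -/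

import Mathlib

open Set Filter Topology Matrix
open scoped ContDiff

namespace ChainedPH

noncomputable section

/-- The column of partial derivatives of a scalar function. -/
def grad {m : ℕ} (f : (Fin m → ℝ) → ℝ) (x : Fin m → ℝ) : Fin m → ℝ :=
  fun i => fderiv ℝ f x (Pi.single i 1)

/-- The Jacobian matrix, with entries `∂ gᵢ / ∂ xⱼ`. -/
def jacobian {m l : ℕ} (g : (Fin m → ℝ) → (Fin l → ℝ)) (x : Fin m → ℝ) :
    Matrix (Fin l) (Fin m) ℝ :=
  Matrix.of fun i j => fderiv ℝ g x (Pi.single j 1) i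

/-- A mechanical port-Hamiltonian system with `n = r + 2` degrees of freedom, `r` Pfaffian
constraints `Gcᵀ(q) q̇ = 0` and two inputs,
`q̇ = ∇_{p₀} H₀`, `ṗ₀ = -∇_q H₀ - D₀ ∇_{p₀} H₀ + G₀ u + Gc λ`, `H₀ = ½ p₀ᵀ M₀⁻¹ p₀ + V`,
on an open set `Ω ⊆ ℝⁿ` of configurations (possibly all of `ℝⁿ`). -/
structure NonholonomicSystem (r : ℕ) where
  Ω : Set (Fin (r + 2) → ℝ)
  isOpen_Ω : IsOpen Ω
  /-- mass matrix -/
  M₀ : (Fin (r + 2) → ℝ) → Matrix (Fin (r + 2)) (Fin (r + 2)) ℝ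
  /-- damping matrix `D₀(p₀, q)` -/
  D₀ : (Fin (r + 2) → ℝ) → (Fin (r + 2) → ℝ) → Matrix (Fin (r + 2)) (Fin (r + 2)) ℝ
  /-- input matrix -/
  G₀ : (Fin (r + 2) → ℝ) → Matrix (Fin (r + 2)) (Fin 2) ℝ
  /-- constraint matrix -/
  Gc : (Fin (r + 2) → ℝ) → Matrix (Fin (r + 2)) (Fin r) ℝ
  /-- potential energy -/
  V : (Fin (r + 2) → ℝ) → ℝ
  contDiffOn_M₀ : ∀ i j, ContDiffOn ℝ ∞ (fun q => M₀ q i j) Ω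
  contDiffOn_D₀ : ∀ i j, ContDiffOn ℝ ∞
    (fun x : (Fin (r + 2) → ℝ) × (Fin (r + 2) → ℝ) => D₀ x.1 x.2 i j) (univ ×ˢ Ω)
  contDiffOn_V : ContDiffOn ℝ ∞ V Ω
  posDef_M₀ : ∀ q ∈ Ω, (M₀ q).PosDef
  posSemidef_D₀ : ∀ p₀, ∀ q ∈ Ω, (D₀ p₀ q).PosSemidef
  rank_Gc : ∀ q ∈ Ω, (Gc q).rank = r
  rank_G₀_Gc : ∀ q ∈ Ω, (Matrix.fromCols (G₀ q) (Gc q)).rank = r + 2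

/-- The choices made when the multipliers are eliminated and the configuration is changed to
`z = f_z(q)`: a left annihilator `Gc^⊥ = Qᵀ` of `Gc` of rank two, and a diffeomorphism `f_z` of the
configuration space onto `ℝⁿ` with `f_z⁻¹(0) = 0`. -/
structure Coordinates {r : ℕ} (S : NonholonomicSystem r) where
  Q : (Fin (r + 2) → ℝ) → Matrix (Fin (r + 2)) (Fin 2) ℝ
  contDiffOn_Q : ∀ i j, ContDiffOn ℝ ∞ (fun q => Q q i j) S.Ω
  annihilates : ∀ q ∈ S.Ω, (Q q)ᵀ * S.Gc q = 0
  rank_Q : ∀ q ∈ S.Ω, (Q q).rank = 2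
  fz : OpenPartialHomeomorph (Fin (r + 2) → ℝ) (Fin (r + 2) → ℝ)
  source_fz : fz.source = S.Ω
  target_fz : fz.target = univ
  contDiffOn_fz : ContDiffOn ℝ ∞ fz S.Ω
  contDiff_fz_symm : ContDiff ℝ ∞ fz.symm
  fz_symm_zero : fz.symm 0 = 0

/-- The inverse `z = f_w⁻¹(w)` of the discontinuous coordinate transformation. Indices are shifted
by one: `w 0` is `w₁`, and `w i.succ.succ` for `i = 0, …, r - 1` is `w_{i+3}`. -/
def fwInv {r : ℕ} (w : Fin (r + 2) → ℝ) : Fin (r + 2) → ℝ := fun j =>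
  if j = 0 then w 0
  else if j = 1 then
    w 0 * w 1 + ∑ i : Fin r,
      1 / (Nat.factorial ((i : ℕ) + 1) : ℝ) * w 0 ^ ((i : ℕ) + 1) * w i.succ.succ
  else ∑ i : Fin r,
      1 / (Nat.factorial ((i : ℕ) + (j : ℕ)) : ℝ) * w 0 ^ ((i : ℕ) + (j : ℕ)) * w i.succ.succ

/-- The transformation `w = f_w(z)`, defined implicitly by `fwInv`. For `z₁ ≠ 0` there is exactly
one `w` with `fwInv w = z`; other values of `z` are never used. -/
def fw {r : ℕ} : (Fin (r + 2) → ℝ) → (Fin (r + 2) → ℝ) := Function.invFun fwInv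

/-- The `(n - 2) × n` matrix whose `j`-th row has `-z_{j+1}` in the first column, `1` in column
`j + 2` and zeros elsewhere (`j = 1, …, n - 2`). -/
def chainedAnnihilator {r : ℕ} (z : Fin (r + 2) → ℝ) : Matrix (Fin r) (Fin (r + 2)) ℝ :=
  Matrix.of fun j c =>
    if c = 0 then - z j.castSucc.succ else if c = j.succ.succ then 1 else 0

/-- The first standard basis vector of `ℝⁿ`. -/
def e₁ (r : ℕ) : Fin (r + 2) → ℝ := Pi.single 0 1

namespace Coordinates

variable {r : ℕ} {S : NonholonomicSystem r} (R : Coordinates S)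

/-! The reduced system without multipliers, in the coordinates `(q, p)` with `p ∈ ℝ²`. -/

/-- `M = Qᵀ M₀ Q` -/
def M (q : Fin (r + 2) → ℝ) : Matrix (Fin 2) (Fin 2) ℝ := (R.Q q)ᵀ * S.M₀ q * R.Q q

/-- `p₀ = M₀ Q (Qᵀ M₀ Q)⁻¹ p` -/
def p₀ (p : Fin 2 → ℝ) (q : Fin (r + 2) → ℝ) : Fin (r + 2) → ℝ :=
  (S.M₀ q * R.Q q * (R.M q)⁻¹) *ᵥ p

/-- `G = Qᵀ G₀` -/
def G (q : Fin (r + 2) → ℝ) : Matrix (Fin 2) (Fin 2) ℝ := (R.Q q)ᵀ * S.G₀ q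

/-- `D = Qᵀ D₀ Q` -/
def D (p : Fin 2 → ℝ) (q : Fin (r + 2) → ℝ) : Matrix (Fin 2) (Fin 2) ℝ :=
  (R.Q q)ᵀ * S.D₀ (R.p₀ p q) q * R.Q q

/-- `C = Qᵀ { (∂p₀/∂q)ᵀ - ∂p₀/∂q } Q` -/
def C (p : Fin 2 → ℝ) (q : Fin (r + 2) → ℝ) : Matrix (Fin 2) (Fin 2) ℝ :=
  (R.Q q)ᵀ * ((jacobian (R.p₀ p) q)ᵀ - jacobian (R.p₀ p) q) * R.Q q

/-! The reduced system in the coordinates `(z, p)`, `z = f_z(q)`. -/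

def Mz (z : Fin (r + 2) → ℝ) : Matrix (Fin 2) (Fin 2) ℝ := R.M (R.fz.symm z)

def Vz (z : Fin (r + 2) → ℝ) : ℝ := S.V (R.fz.symm z)

def Qz (z : Fin (r + 2) → ℝ) : Matrix (Fin (r + 2)) (Fin 2) ℝ :=
  jacobian R.fz (R.fz.symm z) * R.Q (R.fz.symm z)

def Cz (p : Fin 2 → ℝ) (z : Fin (r + 2) → ℝ) : Matrix (Fin 2) (Fin 2) ℝ := R.C p (R.fz.symm z)

def Dz (p : Fin 2 → ℝ) (z : Fin (r + 2) → ℝ) : Matrix (Fin 2) (Fin 2) ℝ := R.D p (R.fz.symm z)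

def Gz (z : Fin (r + 2) → ℝ) : Matrix (Fin 2) (Fin 2) ℝ := R.G (R.fz.symm z)

/-- The system has a chained structure: `chainedAnnihilator` is a left annihilator of `Q_z`. -/
def HasChainedStructure : Prop := ∀ z, chainedAnnihilator z * R.Qz z = 0

/-! The reduced system in the coordinates `(w, p)`, `w = f_w(z)`, defined for `w₁ ≠ 0`. -/

def Mw (w : Fin (r + 2) → ℝ) : Matrix (Fin 2) (Fin 2) ℝ := R.Mz (fwInv w)

def Vw (w : Fin (r + 2) → ℝ) : ℝ := R.Vz (fwInv w)

def Qw (w : Fin (r + 2) → ℝ) : Matrix (Fin (r + 2)) (Fin 2) ℝ :=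
  jacobian fw (fwInv w) * R.Qz (fwInv w)

def Cw (w : Fin (r + 2) → ℝ) (p : Fin 2 → ℝ) : Matrix (Fin 2) (Fin 2) ℝ := R.Cz p (fwInv w)

def Dw (w : Fin (r + 2) → ℝ) (p : Fin 2 → ℝ) : Matrix (Fin 2) (Fin 2) ℝ := R.Dz p (fwInv w)

def Gw (w : Fin (r + 2) → ℝ) : Matrix (Fin 2) (Fin 2) ℝ := R.Gz (fwInv w)

/-- `H_w = ½ pᵀ M_w⁻¹ p + V_w` -/
def Hw (w : Fin (r + 2) → ℝ) (p : Fin 2 → ℝ) : ℝ :=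
  1 / 2 * (p ⬝ᵥ ((R.Mw w)⁻¹ *ᵥ p)) + R.Vw w

/-- The open-loop vector field `(ẇ, ṗ)` with input `u`. -/
def openLoop (w : Fin (r + 2) → ℝ) (p u : Fin 2 → ℝ) : (Fin (r + 2) → ℝ) × (Fin 2 → ℝ) :=
  (R.Qw w *ᵥ grad (fun p' => R.Hw w p') p,
    -((R.Qw w)ᵀ *ᵥ grad (fun w' => R.Hw w' p) w)
      + (R.Cw w p - R.Dw w p) *ᵥ grad (fun p' => R.Hw w p') p + R.Gw w *ᵥ u)

/-- The injected damping `D̂ + (k / w₁²) Q_wᵀ e₁ e₁ᵀ Q_w`. -/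
def injectedDamping (Dhat : Matrix (Fin 2) (Fin 2) ℝ) (k : ℝ) (w : Fin (r + 2) → ℝ) :
    Matrix (Fin 2) (Fin 2) ℝ :=
  Dhat + (k / w 0 ^ 2) •
    ((R.Qw w)ᵀ * Matrix.vecMulVec (e₁ r) (e₁ r) * R.Qw w)

/-- The control law
`u = -G_w⁻¹ { Q_wᵀ [L w - ∇_w V_w] + [D̂ + (k / w₁²) Q_wᵀ e₁ e₁ᵀ Q_w] ∇_p H_w }`,
with `L = diag(l₁, …, lₙ)`. -/
def controlLaw (l : Fin (r + 2) → ℝ) (Dhat : Matrix (Fin 2) (Fin 2) ℝ) (k : ℝ)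
    (w : Fin (r + 2) → ℝ) (p : Fin 2 → ℝ) : Fin 2 → ℝ :=
  -((R.Gw w)⁻¹ *ᵥ ((R.Qw w)ᵀ *ᵥ (Matrix.diagonal l *ᵥ w - grad R.Vw w)
      + R.injectedDamping Dhat k w *ᵥ grad (fun p' => R.Hw w p') p))

/-- `H_d = ½ pᵀ M_w⁻¹ p + ½ wᵀ L w` -/
def Hd (l : Fin (r + 2) → ℝ) (w : Fin (r + 2) → ℝ) (p : Fin 2 → ℝ) : ℝ :=
  1 / 2 * (p ⬝ᵥ ((R.Mw w)⁻¹ *ᵥ p)) + 1 / 2 * (w ⬝ᵥ (Matrix.diagonal l *ᵥ w))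

/-- `D_d = D_w + D̂ + (k / w₁²) Q_wᵀ e₁ e₁ᵀ Q_w` -/
def Dd (Dhat : Matrix (Fin 2) (Fin 2) ℝ) (k : ℝ) (w : Fin (r + 2) → ℝ) (p : Fin 2 → ℝ) :
    Matrix (Fin 2) (Fin 2) ℝ :=
  R.Dw w p + R.injectedDamping Dhat k w

/-- The closed-loop vector field
`ẇ = Q_w ∇_p H_d`, `ṗ = -Q_wᵀ ∇_w H_d + (C_w - D_d) ∇_p H_d`. -/
def closedLoop (l : Fin (r + 2) → ℝ) (Dhat : Matrix (Fin 2) (Fin 2) ℝ) (k : ℝ)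
    (w : Fin (r + 2) → ℝ) (p : Fin 2 → ℝ) : (Fin (r + 2) → ℝ) × (Fin 2 → ℝ) :=
  (R.Qw w *ᵥ grad (fun p' => R.Hd l w p') p,
    -((R.Qw w)ᵀ *ᵥ grad (fun w' => R.Hd l w' p) w)
      + (R.Cw w p - R.Dd Dhat k w p) *ᵥ grad (fun p' => R.Hd l w p') p)

/-- `x = (w, p)` is a solution of the closed loop on the time set `J`: it is continuous and
satisfies the differential equation wherever the latter is defined, that is, at every time with
`w₁(t) ≠ 0` (nothing but continuity is asked at times with `w₁(t) = 0`). -/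
def IsSolutionOn (l : Fin (r + 2) → ℝ) (Dhat : Matrix (Fin 2) (Fin 2) ℝ) (k : ℝ)
    (J : Set ℝ) (x : ℝ → (Fin (r + 2) → ℝ) × (Fin 2 → ℝ)) : Prop :=
  ContinuousOn x J ∧
    ∀ t ∈ J, (x t).1 0 ≠ 0 → HasDerivWithinAt x (R.closedLoop l Dhat k (x t).1 (x t).2) J t

end Coordinates

end

end ChainedPH

/-!
The control law shapes the energy to `H_d` and makes `dH_d/dt ≤ -k (ẇ₁ / w₁)²`. Since `H_d ≥ 0`,
`ẇ₁ / w₁` is square integrable on bounded time intervals, with a bound that does not see the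
solution come close to `w₁ = 0`: hence `w₁` decays at most exponentially, and a solution stays in a
compact subset of `{w₁ ≠ 0}` on every bounded time interval, which gives global existence.

Let `(w, p)` be a cluster point of a solution with `w₁ ≠ 0`. As `H_d` has a limit, LaSalle's
argument gives `p = 0` and `ṗ = -Q_wᵀ L w = 0` there. By the chained structure, the image of `Q_w`
contains the directions `(0, 1, 0, …, 0)` and, where `w₂ = 0`, `(1, 0, …, 0)`; this forces first
`w₂ = 0` and then `w₁ = 0`. So `w₁ → 0` along every solution, and since `w` is bounded and
`f_w⁻¹(w) = 0` when `w₁ = 0`, also `z → 0`. That `f_w⁻¹` is a local diffeomorphism off `w₁ = 0`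
rests on the nonsingularity of the Hankel matrices with entries `1 / (a + b + s)!`.
-/

namespace ChainedPH

section IntegralCurves

open scoped NNReal Manifold

variable {E : Type*} [NormedAddCommGroup E] [NormedSpace ℝ E] {f : E → E} {U K : Set E}
  {x y : ℝ → E} {x₀ : E} {a b : ℝ}

theorem hasDerivWithinAt_Ici_of_isIntegralCurveOn_Icc {t : ℝ}
    (hx : IsIntegralCurveOn x (fun _ => f) (Icc a b)) (ht : t ∈ Ico a b) :
    HasDerivWithinAt x (f (x t)) (Ici t) t :=
  (hx t (Ico_subset_Icc_self ht)).mono_of_mem_nhdsWithin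
    (mem_of_superset (Icc_mem_nhdsGE ht.2) (Icc_subset_Icc_left ht.1))

theorem eqOn_Icc_of_locallyLipschitzOn (hf : LocallyLipschitzOn U f)
    (hx : IsIntegralCurveOn x (fun _ => f) (Icc a b)) (hxU : MapsTo x (Icc a b) U)
    (hy : IsIntegralCurveOn y (fun _ => f) (Icc a b)) (hyU : MapsTo y (Icc a b) U)
    (hxy : x a = y a) : EqOn x y (Icc a b) := by
  obtain ⟨C, hC⟩ := (hf.mono (union_subset hxU.image_subset hyU.image_subset)
    ).exists_lipschitzOnWith_of_compact
      ((isCompact_Icc.image_of_continuousOn hx.continuousOn).union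
        (isCompact_Icc.image_of_continuousOn hy.continuousOn))
  exact ODE_solution_unique_of_mem_Icc_right (v := fun _ => f) (fun _ _ => hC)
    hx.continuousOn (fun _ => hasDerivWithinAt_Ici_of_isIntegralCurveOn_Icc hx)
    (fun _ ht => Or.inl (mem_image_of_mem x (Ico_subset_Icc_self ht)))
    hy.continuousOn (fun _ => hasDerivWithinAt_Ici_of_isIntegralCurveOn_Icc hy)
    (fun _ ht => Or.inr (mem_image_of_mem y (Ico_subset_Icc_self ht))) hxy

theorem locallyLipschitzOn_of_contDiffOn (hU : IsOpen U) (hf : ContDiffOn ℝ 1 f U) :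
    LocallyLipschitzOn U f := fun p hp => by
  obtain ⟨C, t, ht, hC⟩ := (hf.contDiffAt (hU.mem_nhds hp)).exists_lipschitzOnWith
  exact ⟨C, t, mem_nhdsWithin_of_mem_nhds ht, hC⟩

theorem contDiff_of_contDiffOn_of_tsupport_subset {n : WithTop ℕ∞} (hU : IsOpen U)
    (hf : ContDiffOn ℝ n f U) (hsupp : tsupport f ⊆ U) : ContDiff ℝ n f := by
  refine contDiff_iff_contDiffAt.2 fun p => ?_
  by_cases hp : p ∈ tsupport f
  · exact hf.contDiffAt (hU.mem_nhds (hsupp hp))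
  · exact contDiffAt_const.congr_of_eventuallyEq (notMem_tsupport_iff_eventuallyEq.1 hp)

theorem exists_lipschitzWith_bounded_eqOn [FiniteDimensional ℝ E] (hU : IsOpen U)
    (hf : ContDiffOn ℝ 1 f U) (hK : IsCompact K) (hKU : K ⊆ U) :
    ∃ (g : E → E) (W : Set E) (C B : ℝ≥0), IsOpen W ∧ K ⊆ W ∧ W ⊆ U ∧ EqOn g f W ∧
      LipschitzWith C g ∧ ∀ p, ‖g p‖ ≤ B := by
  obtain ⟨L, hL, hKL, hLU⟩ := exists_compact_between hK hU hKU
  obtain ⟨χ, hχ1, hχ0, -⟩ := exists_contMDiffMap_one_nhds_of_subset_interior (n := 1) 𝓘(ℝ, E)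
    hK.isClosed hKL
  have hsupp : tsupport (fun p => χ p • f p) ⊆ L :=
    closure_minimal (fun p hp => of_not_not fun hpL => hp (by simp [hχ0 p hpL])) hL.isClosed
  have hcpt : HasCompactSupport (fun p => χ p • f p) :=
    hL.of_isClosed_subset (isClosed_tsupport _) hsupp
  have hg : ContDiff ℝ 1 (fun p => χ p • f p) :=
    contDiff_of_contDiffOn_of_tsupport_subset hU (χ.contMDiff.contDiff.contDiffOn.smul hf)
      (hsupp.trans hLU)
  obtain ⟨C, hC⟩ := hg.lipschitzWith_of_hasCompactSupport hcpt one_ne_zero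
  obtain ⟨B, hB⟩ := hcpt.exists_bound_of_continuous hg.continuous
  obtain ⟨W, hW, hKW, hW1⟩ := eventually_nhdsSet_iff_exists.1 hχ1
  exact ⟨_, W ∩ U, C, B.toNNReal, hW.inter hU, subset_inter hKW hKU, inter_subset_right,
    fun p hp => by simp [hW1 p hp.1], hC, fun p => (hB p).trans (Real.le_coe_toNNReal B)⟩

theorem exists_isIntegralCurveOn_Icc_of_lipschitzWith [CompleteSpace E] {C B : ℝ≥0}
    (hf : LipschitzWith C f) (hB : ∀ p, ‖f p‖ ≤ B) (hab : a ≤ b) (x₀ : E) :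
    ∃ x : ℝ → E, x a = x₀ ∧ IsIntegralCurveOn x (fun _ => f) (Icc a b) := by
  have h : IsPicardLindelof (fun _ => f) (⟨a, left_mem_Icc.2 hab⟩ : Icc a b) x₀
      (B * ⟨b - a, sub_nonneg.2 hab⟩) 0 B C :=
    { lipschitzOnWith := fun _ _ => hf.lipschitzOnWith
      continuousOn := fun _ _ => continuousOn_const
      norm_le := fun _ _ p _ => hB p
      mul_max_le := by
        simp only [sub_self, max_eq_left (sub_nonneg.2 hab)]
        exact (sub_zero _).ge }
  exact h.exists_eq_forall_mem_Icc_hasDerivWithinAt₀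

theorem exists_isIntegralCurveOn_Icc_of_apriori [FiniteDimensional ℝ E] (hU : IsOpen U)
    (hf : ContDiffOn ℝ 1 f U) (hK : IsCompact K) (hKU : K ⊆ U) (hab : a ≤ b) (hx₀ : x₀ ∈ K)
    (hap : ∀ t ∈ Icc a b, ∀ x : ℝ → E, x a = x₀ → IsIntegralCurveOn x (fun _ => f) (Icc a t) →
      MapsTo x (Icc a t) U → x t ∈ K) :
    ∃ x : ℝ → E, x a = x₀ ∧ IsIntegralCurveOn x (fun _ => f) (Icc a b) ∧
      MapsTo x (Icc a b) U := by
  obtain ⟨g, W, _, _, hW, hKW, hWU, hgf, hg, hB⟩ := exists_lipschitzWith_bounded_eqOn hU hf hK hKU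
  have := FiniteDimensional.complete ℝ E
  obtain ⟨x, rfl, hx⟩ := exists_isIntegralCurveOn_Icc_of_lipschitzWith hg hB hab x₀
  suffices hxW : MapsTo x (Icc a b) W from
    ⟨x, rfl, fun t ht => (hx t ht).congr_deriv (hgf (hxW ht)), hxW.mono_right hWU⟩
  by_contra hexit
  have hbad : IsCompact (Icc a b ∩ x ⁻¹' Wᶜ) := isCompact_Icc.of_isClosed_subset
    (hx.continuousOn.preimage_isClosed_of_isClosed isClosed_Icc hW.isClosed_compl)
    inter_subset_left
  obtain ⟨s, ⟨hs, hsW⟩, hleast⟩ := hbad.exists_isLeast (not_subset.1 hexit)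
  have hbefore : ∀ t ∈ Ico a s, x t ∈ W := fun t ht => of_not_not fun htW =>
    (hleast ⟨⟨ht.1, ht.2.le.trans hs.2⟩, htW⟩).not_gt ht.2
  have has : a < s := hs.1.lt_of_ne fun h => hsW (hKW (h ▸ hx₀))
  have hxK : MapsTo x (Ico a s) K := fun t ht => by
    have hsub : Icc a t ⊆ Ico a s := fun u hu => ⟨hu.1, hu.2.trans_lt ht.2⟩
    have htb : t ≤ b := ht.2.le.trans hs.2
    refine hap t ⟨ht.1, htb⟩ x rfl (fun u hu => ?_) fun u hu => hWU (hbefore u (hsub hu))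
    exact (hx.mono (Icc_subset_Icc_right htb) u hu).congr_deriv (hgf (hbefore u (hsub hu)))
  have hsK : x s ∈ closure K := ((hx.continuousOn s hs).mono
    (Ico_subset_Icc_self.trans (Icc_subset_Icc_right hs.2))).mem_closure
      ((closure_Ico has.ne).symm ▸ right_mem_Icc.2 has.le) hxK
  exact hsW (hKW (hK.isClosed.closure_subset hsK))

theorem exists_isIntegralCurveOn_Ici_of_forall_Icc (hf : LocallyLipschitzOn U f)
    (hex : ∀ b, a ≤ b → ∃ x : ℝ → E, x a = x₀ ∧ IsIntegralCurveOn x (fun _ => f) (Icc a b) ∧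
      MapsTo x (Icc a b) U) :
    ∃ x : ℝ → E, x a = x₀ ∧ IsIntegralCurveOn x (fun _ => f) (Ici a) ∧ MapsTo x (Ici a) U := by
  choose! y hya hy hyU using hex
  have hagree : ∀ b c t, t ∈ Icc a b → t ∈ Icc a c → y b t = y c t := fun b c t hb hc => by
    have hab := hb.1.trans hb.2
    have hac := hc.1.trans hc.2
    exact eqOn_Icc_of_locallyLipschitzOn hf
      ((hy b hab).mono (Icc_subset_Icc_right hb.2)) ((hyU b hab).mono_left
        (Icc_subset_Icc_right hb.2))
      ((hy c hac).mono (Icc_subset_Icc_right hc.2)) ((hyU c hac).mono_left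
        (Icc_subset_Icc_right hc.2))
      ((hya b hab).trans (hya c hac).symm) ⟨hb.1, le_rfl⟩
  refine ⟨fun t => y (t + 1) t, hya _ (by simp), fun t ht => ?_, fun t ht =>
    hyU _ (le_add_of_le_of_nonneg ht zero_le_one) ⟨ht, by simp⟩⟩
  have hat : a ≤ t + 1 := le_add_of_le_of_nonneg ht zero_le_one
  have heq : EqOn (fun s => y (s + 1) s) (y (t + 1)) (Icc a (t + 1)) := fun s hs =>
    hagree _ _ s ⟨hs.1, by simp⟩ hs
  have hmem : t ∈ Icc a (t + 1) := ⟨ht, by simp⟩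
  refine ((hy _ hat t hmem).congr heq (heq hmem)).mono_of_mem_nhdsWithin ?_
  rw [← Ici_inter_Iic]
  exact inter_mem self_mem_nhdsWithin (mem_nhdsWithin_of_mem_nhds (Iic_mem_nhds (lt_add_one t)))

theorem exists_forall_Icc_mem_of_mapClusterPt {p : E} {N : Set E}
    (hx : IsIntegralCurveOn x (fun _ => f) (Ici a)) (hp : MapClusterPt p atTop x)
    (hf : ContinuousAt f p) (hN : N ∈ 𝓝 p) :
    ∃ τ > 0, ∃ᶠ t in atTop, ∀ s ∈ Icc t (t + τ), x s ∈ N := by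
  obtain ⟨B, hB⟩ := exists_gt ‖f p‖
  have hB0 : 0 < B := (norm_nonneg _).trans_lt hB
  obtain ⟨ρ, hρ, hball⟩ := Metric.nhds_basis_closedBall.eventually_iff.1
    ((eventually_mem_set.2 hN).and (hf.norm.eventually_lt_const hB))
  refine ⟨ρ / 2 / B, by positivity, ((hp.frequently (Metric.ball_mem_nhds p (half_pos hρ))
    ).and_eventually (eventually_ge_atTop a)).mono fun t ⟨htp, hta⟩ => ?_⟩
  have hclose : ∀ s ≤ t + ρ / 2 / B, ‖x s - x t‖ ≤ B * (s - t) → x s ∈ Metric.closedBall p ρ :=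
    fun s hs hst => by
      have hρ2 : B * (s - t) ≤ ρ / 2 := by
        rw [← le_div_iff₀' hB0]
        linarith
      rw [Metric.mem_closedBall]
      linarith [dist_triangle (x s) (x t) p, dist_eq_norm (x s) (x t), Metric.mem_ball.1 htp]
  intro s hs
  refine (hball (hclose s hs.2 ?_)).1
  exact image_norm_le_of_norm_deriv_right_lt_deriv_boundary (f := fun s => x s - x t)
    (f' := fun s => f (x s)) (B := fun s => B * (s - t)) (B' := fun _ => B)
    ((hx.continuousOn.mono fun u hu => hta.trans hu.1).sub continuousOn_const)
    (fun u hu => ((hx u (hta.trans hu.1)).mono (Ici_subset_Ici.2 (hta.trans hu.1))).sub_const _)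
    (by simp) (fun u => by simpa using ((hasDerivAt_id u).sub_const t).const_mul B)
    (fun u hu heq => (hball (hclose u hu.2.le heq.le)).2) hs

theorem rate_eq_zero_of_mapClusterPt {F : Type*} [NormedAddCommGroup F] [NormedSpace ℝ F]
    {φ ψ : E → F} {p : E} {N : Set E}
    (hx : IsIntegralCurveOn x (fun _ => f) (Ici a)) (hp : MapClusterPt p atTop x)
    (hf : ContinuousAt f p) (hψ : ContinuousAt ψ p) (hN : N ∈ 𝓝 p)
    (hφ : ∀ t ∈ Ici a, HasDerivWithinAt (φ ∘ x) (ψ (x t)) (Ici a) t)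
    (hlim : Tendsto (φ ∘ x) (atTop ⊓ 𝓟 (x ⁻¹' N)) (𝓝 0)) : ψ p = 0 := by
  suffices h : ∀ ε > 0, ‖ψ p‖ ≤ 0 + 3 * ε from
    norm_le_zero_iff.1 (le_of_forall_pos_le_add fun ε hε => by
      simpa [mul_div_cancel₀] using h (ε / 3) (by positivity))
  intro ε hε
  have hnear : N ∩ {y | ‖ψ y - ψ p‖ ≤ ε} ∈ 𝓝 p :=
    inter_mem hN ((tendsto_iff_norm_sub_tendsto_zero.1 hψ).eventually_le_const hε)
  obtain ⟨τ, hτ, hstay⟩ := exists_forall_Icc_mem_of_mapClusterPt hx hp hf hnear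
  have hsmall : ∀ᶠ t in atTop, x t ∈ N → ‖φ (x t)‖ ≤ ε * τ :=
    eventually_inf_principal.1 ((tendsto_zero_iff_norm_tendsto_zero.1 hlim).eventually_le_const
      (mul_pos hε hτ))
  obtain ⟨T, hT⟩ := eventually_atTop.1 hsmall
  obtain ⟨t, ht, htT⟩ := (hstay.and_eventually (eventually_ge_atTop (max a T))).exists
  have hta : a ≤ t := (le_max_left _ _).trans htT
  have htT : T ≤ t := (le_max_right _ _).trans htT
  have hgrow : ‖φ (x (t + τ)) - (t + τ) • ψ p - (φ (x t) - t • ψ p)‖ ≤ ε * (t + τ - t) :=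
    norm_image_sub_le_of_norm_deriv_le_segment' (f := fun s => φ (x s) - s • ψ p)
      (f' := fun s => ψ (x s) - ψ p)
      (fun s hs => ((hφ s (hta.trans hs.1)).mono fun u hu => hta.trans hu.1).sub (by
        simpa using (hasDerivWithinAt_id s _).smul_const (ψ p)))
      (fun s hs => (ht s (Ico_subset_Icc_self hs)).2) _ ⟨by linarith, le_rfl⟩
  have hstart := hT t htT (ht t ⟨le_rfl, by linarith⟩).1
  have hend := hT (t + τ) (by linarith) (ht (t + τ) ⟨by linarith, le_rfl⟩).1
  have hτψ : τ * ‖ψ p‖ ≤ τ * (3 * ε) := calc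
    τ * ‖ψ p‖ = ‖τ • ψ p‖ := by rw [norm_smul, Real.norm_of_nonneg hτ.le]
    _ = ‖φ (x (t + τ)) - φ (x t)
          - (φ (x (t + τ)) - (t + τ) • ψ p - (φ (x t) - t • ψ p))‖ := by congr 1; module
    _ ≤ ‖φ (x (t + τ))‖ + ‖φ (x t)‖ + ε * (t + τ - t) :=
      (norm_sub_le _ _).trans (add_le_add (norm_sub_le _ _) hgrow)
    _ ≤ τ * (3 * ε) := by linarith
  rw [zero_add]
  exact le_of_mul_le_mul_left hτψ hτ

end IntegralCurves

theorem tendsto_comp_of_forall_mapClusterPt {α X Y : Type*} [TopologicalSpace X]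
    [TopologicalSpace Y] {l : Filter α} {u : α → X} {K : Set X} {φ : X → Y} {y : Y}
    (hK : IsCompact K) (hu : ∀ᶠ t in l, u t ∈ K) (hφ : Continuous φ)
    (h : ∀ p ∈ K, MapClusterPt p l u → φ p = y) : Tendsto (φ ∘ u) l (𝓝 y) := by
  refine tendsto_iff_ultrafilter _ _ _ |>.2 fun g hg => ?_
  obtain ⟨p, hpK, hp⟩ := hK.ultrafilter_le_nhds (g.map u) (le_principal_iff.2 (hg hu))
  rw [← h p hpK (mapClusterPt_iff_ultrafilter.2 ⟨g, hg, hp⟩)]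
  exact hφ.continuousAt.tendsto.comp hp

section SingularDamping

variable {E : Type*} [NormedAddCommGroup E] [NormedSpace ℝ E]

/-- `x` is a solution on `J` of `ẋ = f x`, for a vector field that is only meaningful off the
hyperplane `c = 0`: the curve is continuous, and it satisfies the equation whenever it is off this
hyperplane. -/
def IsSolutionOff (f : E → E) (c : E →L[ℝ] ℝ) (J : Set ℝ) (x : ℝ → E) : Prop :=
  ContinuousOn x J ∧ ∀ t ∈ J, c (x t) ≠ 0 → HasDerivWithinAt x (f (x t)) J t

/-- A nonnegative energy `H` that `ẏ = f y` dissipates at least at the rate `k (ċ / c)²`: the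
damping is singular on the hyperplane `c = 0`, where nothing is required of `f`. -/
structure IsSingularStorage (f : E → E) (H : E → ℝ) (c : E →L[ℝ] ℝ) (k : ℝ) : Prop where
  pos : 0 < k
  contDiff : ContDiff ℝ 1 H
  nonneg : ∀ y, 0 ≤ H y
  fderiv_le : ∀ y, c y ≠ 0 → fderiv ℝ H y (f y) ≤ -k * (c (f y) / c y) ^ 2

variable {f : E → E} {H : E → ℝ} {c : E →L[ℝ] ℝ} {k a b : ℝ} {x : ℝ → E} {J J' : Set ℝ}

namespace IsSolutionOff

theorem mono (hx : IsSolutionOff f c J x) (hJ : J' ⊆ J) : IsSolutionOff f c J' x :=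
  ⟨hx.1.mono hJ, fun t ht hc => (hx.2 t (hJ ht) hc).mono hJ⟩

theorem hasDerivAt (hx : IsSolutionOff f c (Icc a b) x) {t : ℝ} (ht : t ∈ Ioo a b)
    (hc : c (x t) ≠ 0) : HasDerivAt x (f (x t)) t :=
  (hx.2 t (Ioo_subset_Icc_self ht) hc).hasDerivAt (Icc_mem_nhds ht.1 ht.2)

theorem isIntegralCurveOn (hx : IsSolutionOff f c J x) (hc : ∀ t ∈ J, c (x t) ≠ 0) :
    IsIntegralCurveOn x (fun _ => f) J :=
  fun t ht => hx.2 t ht (hc t ht)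

end IsSolutionOff

theorem isSolutionOff_of_isIntegralCurveOn (hx : IsIntegralCurveOn x (fun _ => f) J) :
    IsSolutionOff f c J x :=
  ⟨hx.continuousOn, fun t ht _ => hx t ht⟩

theorem isOpen_ne_zero (c : E →L[ℝ] ℝ) : IsOpen {y | c y ≠ 0} :=
  isOpen_ne_fun c.continuous continuous_const

namespace IsSingularStorage

theorem differentiable (hS : IsSingularStorage f H c k) : Differentiable ℝ H :=
  hS.contDiff.differentiable one_ne_zero

theorem energy_le (hS : IsSingularStorage f H c k) (hx : IsSolutionOff f c (Icc a b) x)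
    (hc : ∀ t ∈ Ioo a b, c (x t) ≠ 0) (hab : a ≤ b) : H (x b) ≤ H (x a) := by
  have hanti : AntitoneOn (H ∘ x) (Icc a b) := by
    refine antitoneOn_of_hasDerivWithinAt_nonpos (convex_Icc a b)
      (f' := fun t => fderiv ℝ H (x t) (f (x t)))
      (hS.contDiff.continuous.comp_continuousOn hx.1) (fun t ht => ?_) fun t ht => ?_
    all_goals rw [interior_Icc] at ht
    · exact ((hS.differentiable _).hasFDerivAt.comp_hasDerivAt t
        (hx.hasDerivAt ht (hc t ht))).hasDerivWithinAt
    · refine (hS.fderiv_le _ (hc t ht)).trans ?_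
      rw [neg_mul]
      exact neg_nonpos.2 (mul_nonneg hS.pos.le (sq_nonneg _))
  exact hanti ⟨le_rfl, hab⟩ ⟨hab, le_rfl⟩ hab

/- With `v = ċ / c`, the logarithmic derivative of `exp (t - H / k) c²` is
`1 - Ḣ / k + 2 v ≥ (1 + v)²`. -/
theorem exp_mul_sq_le_sq (hS : IsSingularStorage f H c k) (hx : IsSolutionOff f c (Icc a b) x)
    (hc : ∀ t ∈ Ioo a b, c (x t) ≠ 0) (hab : a ≤ b) :
    Real.exp (a - b - H (x a) / k) * c (x a) ^ 2 ≤ c (x b) ^ 2 := by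
  have hmono : MonotoneOn (fun t => Real.exp (t - H (x t) / k) * c (x t) ^ 2) (Icc a b) := by
    refine monotoneOn_of_hasDerivWithinAt_nonneg (convex_Icc a b)
      (f' := fun t => Real.exp (t - H (x t) / k) * (1 - fderiv ℝ H (x t) (f (x t)) / k)
        * c (x t) ^ 2 + Real.exp (t - H (x t) / k) * (2 * c (x t) * c (f (x t))))
      ?_ (fun t ht => ?_) fun t ht => ?_
    · have hHx := hS.contDiff.continuous.comp_continuousOn hx.1
      have hcx := c.continuous.comp_continuousOn hx.1
      exact (Real.continuous_exp.comp_continuousOn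
        (continuousOn_id.sub (hHx.div_const k))).mul (hcx.pow 2)
    all_goals rw [interior_Icc] at ht
    · have hxt := hx.hasDerivAt ht (hc t ht)
      have hHt := (hS.differentiable _).hasFDerivAt.comp_hasDerivAt t hxt
      have hct := c.hasFDerivAt.comp_hasDerivAt t hxt
      have hprod := (((hasDerivAt_id t).sub (hHt.div_const k)).exp).mul (hct.pow 2)
      exact hprod.hasDerivWithinAt.congr_deriv (by simp)
    · have hct := hc t ht
      set v := c (f (x t)) / c (x t) with hv
      have hcf : c (f (x t)) = v * c (x t) := by rw [hv, div_mul_cancel₀ _ hct]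
      have hdiss : fderiv ℝ H (x t) (f (x t)) / k ≤ -v ^ 2 := by
        rw [div_le_iff₀ hS.pos]
        linarith [hS.fderiv_le _ hct]
      calc 0 ≤ Real.exp (t - H (x t) / k) * c (x t) ^ 2
            * ((1 + v) ^ 2 + (-v ^ 2 - fderiv ℝ H (x t) (f (x t)) / k)) := by
            have := sub_nonneg.2 hdiss
            positivity
        _ = _ := by rw [hcf]; ring
  have hle := hmono ⟨le_rfl, hab⟩ ⟨hab, le_rfl⟩ hab
  calc Real.exp (a - b - H (x a) / k) * c (x a) ^ 2
      = Real.exp (-b) * (Real.exp (a - H (x a) / k) * c (x a) ^ 2) := by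
        rw [← mul_assoc, ← Real.exp_add]
        ring_nf
    _ ≤ Real.exp (-b) * (Real.exp (b - H (x b) / k) * c (x b) ^ 2) := by gcongr
    _ = Real.exp (-(H (x b) / k)) * c (x b) ^ 2 := by
        rw [← mul_assoc, ← Real.exp_add]
        ring_nf
    _ ≤ c (x b) ^ 2 := mul_le_of_le_one_left (sq_nonneg _)
        (Real.exp_le_one_iff.2 (neg_nonpos.2 (div_nonneg (hS.nonneg _) hS.pos.le)))

theorem ne_zero_of_Icc (hS : IsSingularStorage f H c k) (hx : IsSolutionOff f c (Icc a b) x)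
    (hca : c (x a) ≠ 0) (hab : a ≤ b) : c (x b) ≠ 0 := by
  intro hcb
  have hzeros : IsCompact (Icc a b ∩ (c ∘ x) ⁻¹' {0}) := isCompact_Icc.of_isClosed_subset
    ((c.continuous.comp_continuousOn hx.1).preimage_isClosed_of_isClosed isClosed_Icc
      isClosed_singleton) inter_subset_left
  obtain ⟨s, ⟨hs, hs0⟩, hleast⟩ := hzeros.exists_isLeast ⟨b, ⟨hab, le_rfl⟩, hcb⟩
  have hbefore : ∀ t ∈ Ioo a s, c (x t) ≠ 0 := fun t ht h =>
    (hleast ⟨⟨ht.1.le, ht.2.le.trans hs.2⟩, h⟩).not_gt ht.2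
  have hle := hS.exp_mul_sq_le_sq (hx.mono (Icc_subset_Icc_right hs.2)) hbefore hs.1
  rw [show c (x s) = 0 from hs0, zero_pow two_ne_zero] at hle
  exact hle.not_gt (by positivity)

theorem ne_zero (hS : IsSingularStorage f H c k) (hJ : J.OrdConnected)
    (hx : IsSolutionOff f c J x) (ha : a ∈ J) (hca : c (x a) ≠ 0) :
    ∀ t ∈ J, a ≤ t → c (x t) ≠ 0 :=
  fun _ ht hat => hS.ne_zero_of_Icc (hx.mono (hJ.out ha ht)) hca hat

theorem antitoneOn_energy (hS : IsSingularStorage f H c k) (hx : IsSolutionOff f c (Ici a) x)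
    (hca : c (x a) ≠ 0) : AntitoneOn (H ∘ x) (Ici a) := fun _ hs _ _ hst =>
  hS.energy_le (hx.mono fun _ hu => hs.trans hu.1)
    (fun _ hu => hS.ne_zero ordConnected_Ici hx self_mem_Ici hca _ (hs.trans hu.1.le)
      (hs.trans hu.1.le)) hst

theorem eqOn_Icc (hS : IsSingularStorage f H c k) (hf : LocallyLipschitzOn {y | c y ≠ 0} f)
    {y : ℝ → E} (hx : IsSolutionOff f c (Icc a b) x) (hy : IsSolutionOff f c (Icc a b) y)
    (hca : c (x a) ≠ 0) (hxy : x a = y a) : EqOn x y (Icc a b) := fun t ht => by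
  have ha : a ∈ Icc a b := ⟨le_rfl, ht.1.trans ht.2⟩
  have hcx := fun s hs => hS.ne_zero ordConnected_Icc hx ha hca s hs hs.1
  have hcy := fun s hs => hS.ne_zero ordConnected_Icc hy ha (hxy ▸ hca) s hs hs.1
  exact eqOn_Icc_of_locallyLipschitzOn hf (hx.isIntegralCurveOn hcx) hcx
    (hy.isIntegralCurveOn hcy) hcy hxy ht

theorem exists_isSolutionOff [FiniteDimensional ℝ E] (hS : IsSingularStorage f H c k)
    (hf : ContDiffOn ℝ 1 f {y | c y ≠ 0}) (hH : ∀ h, IsCompact {y | H y ≤ h}) (a : ℝ) {x₀ : E}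
    (hx₀ : c x₀ ≠ 0) : ∃ x : ℝ → E, IsSolutionOff f c (Ici a) x ∧ x a = x₀ := by
  have hU := isOpen_ne_zero c
  suffices hex : ∀ b, a ≤ b → ∃ x : ℝ → E, x a = x₀ ∧ IsIntegralCurveOn x (fun _ => f) (Icc a b) ∧
      MapsTo x (Icc a b) {y | c y ≠ 0} by
    obtain ⟨x, hxa, hx, -⟩ := exists_isIntegralCurveOn_Ici_of_forall_Icc
      (locallyLipschitzOn_of_contDiffOn hU hf) hex
    exact ⟨x, isSolutionOff_of_isIntegralCurveOn hx, hxa⟩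
  intro b hab
  let ε := Real.exp (a - b - H x₀ / k) * c x₀ ^ 2
  have hε : 0 < ε := by positivity
  refine exists_isIntegralCurveOn_Icc_of_apriori (K := {y | H y ≤ H x₀} ∩ {y | ε ≤ c y ^ 2}) hU hf
    ((hH _).inter_right (isClosed_le continuous_const (c.continuous.pow 2)))
    (fun y hy => pow_ne_zero_iff two_ne_zero |>.1 (hε.trans_le hy.2).ne') hab
    ⟨le_refl (H x₀), ?_⟩ ?_
  · refine mul_le_of_le_one_left (sq_nonneg _) (Real.exp_le_one_iff.2 ?_)
    have := div_nonneg (hS.nonneg x₀) hS.pos.le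
    linarith
  · rintro t ht x rfl hx hcx
    have hxc := isSolutionOff_of_isIntegralCurveOn (c := c) hx
    have hcx' : ∀ s ∈ Ioo a t, c (x s) ≠ 0 := fun s hs => hcx (Ioo_subset_Icc_self hs)
    refine ⟨hS.energy_le hxc hcx' ht.1, le_trans ?_ (hS.exp_mul_sq_le_sq hxc hcx' ht.1)⟩
    exact mul_le_mul_of_nonneg_right (Real.exp_le_exp.2 (by linarith [ht.2])) (sq_nonneg _)

theorem fderiv_eq_zero_of_mapClusterPt (hS : IsSingularStorage f H c k)
    (hf : ContinuousOn f {y | c y ≠ 0}) (hx : IsSolutionOff f c (Ici a) x) (hca : c (x a) ≠ 0)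
    {p : E} (hp : MapClusterPt p atTop x) (hcp : c p ≠ 0) : fderiv ℝ H p (f p) = 0 := by
  have hcurve : IsIntegralCurveOn x (fun _ => f) (Ici a) :=
    hx.isIntegralCurveOn fun t ht => hS.ne_zero ordConnected_Ici hx self_mem_Ici hca t ht ht
  obtain ⟨h, hh⟩ : ∃ h, Tendsto (H ∘ x) atTop (𝓝 h) := by
    refine ⟨_, tendsto_comp_val_Ici_atTop.1 (tendsto_atTop_ciInf
      (antitoneOn_iff_antitone.1 (hS.antitoneOn_energy hx hca)) ⟨0, ?_⟩)⟩
    rintro _ ⟨t, rfl⟩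
    exact hS.nonneg _
  have hfp := hf.continuousAt ((isOpen_ne_zero c).mem_nhds hcp)
  refine rate_eq_zero_of_mapClusterPt (φ := fun y => H y - h) hcurve hp hfp
    (ψ := fun y => fderiv ℝ H y (f y))
    ((hS.contDiff.continuous_fderiv one_ne_zero).continuousAt.clm_apply hfp) univ_mem
    (fun t ht => ((hS.differentiable _).hasFDerivAt.comp_hasDerivWithinAt t
      (hcurve t ht)).sub_const h) ?_
  simpa [Function.comp_def] using hh.sub_const h

/- The energy has a limit, so it does not decrease at a cluster point `p` off the hyperplane; hence
`π` vanishes at all cluster points near `p`, and its rate `π (f p)` vanishes as well. -/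
theorem tendsto_zero (hS : IsSingularStorage f H c k) (hf : ContinuousOn f {y | c y ≠ 0})
    (hH : ∀ h, IsCompact {y | H y ≤ h}) {F : Type*} [NormedAddCommGroup F] [NormedSpace ℝ F]
    {π : E →L[ℝ] F} (hstrict : ∀ y, c y ≠ 0 → fderiv ℝ H y (f y) = 0 → π y = 0)
    (hrest : ∀ y, c y ≠ 0 → π y = 0 → π (f y) ≠ 0)
    (hx : IsSolutionOff f c (Ici a) x) (hca : c (x a) ≠ 0) :
    Tendsto (fun t => c (x t)) atTop (𝓝 0) := by
  have hcurve : IsIntegralCurveOn x (fun _ => f) (Ici a) :=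
    hx.isIntegralCurveOn fun t ht => hS.ne_zero ordConnected_Ici hx self_mem_Ici hca t ht ht
  have hsublevel : ∀ᶠ t in atTop, x t ∈ {y | H y ≤ H (x a)} := by
    filter_upwards [eventually_ge_atTop a] with t ht
    exact hS.antitoneOn_energy hx hca self_mem_Ici ht ht
  have hcluster : ∀ p, MapClusterPt p atTop x → c p ≠ 0 → π p = 0 := fun p hp hcp =>
    hstrict p hcp (hS.fderiv_eq_zero_of_mapClusterPt hf hx hca hp hcp)
  refine tendsto_comp_of_forall_mapClusterPt (hH _) hsublevel c.continuous fun p _ hp => ?_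
  by_contra hcp
  let N := {z | |c p| / 2 ≤ |c z|}
  have hN : N ∈ 𝓝 p :=
    c.continuous.abs.continuousAt.eventually_const_le (half_lt_self (abs_pos.2 hcp))
  have hfp := hf.continuousAt ((isOpen_ne_zero c).mem_nhds hcp)
  refine hrest p hcp (hcluster p hp hcp) (rate_eq_zero_of_mapClusterPt (φ := π)
    (ψ := fun y => π (f y)) hcurve hp hfp (π.continuous.continuousAt.comp hfp) hN
    (fun t ht => π.hasFDerivAt.comp_hasDerivWithinAt t (hcurve t ht)) ?_)
  refine tendsto_comp_of_forall_mapClusterPt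
    ((hH (H (x a))).inter_right (isClosed_le continuous_const c.continuous.abs : IsClosed N))
    (eventually_inf_principal.2 (hsublevel.mono fun t ht htN => ⟨ht, htN⟩)) π.continuous
    fun q hqN hq => hcluster q (hq.mono inf_le_left) ?_
  exact abs_pos.1 ((half_pos (abs_pos.2 hcp)).trans_le hqN.2)

end IsSingularStorage

end SingularDamping

section InverseFactorialHankel

open Polynomial

variable {K : Type*} [Field K]

theorem eq_zero_of_pow_dvd_of_natDegree_lt {P : K[X]} {m n : ℕ} {a : K} (ha : a ≠ 0)
    (hX : X ^ m ∣ P) (hXa : (X - C a) ^ n ∣ P) (hdeg : P.natDegree < m + n) : P = 0 := by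
  have hcoprime : IsCoprime (X ^ m : K[X]) ((X - C a) ^ n) := by
    simpa using (isCoprime_X_sub_C_of_isUnit_sub (a := (0 : K)) (b := a) (by simpa using ha)).pow
  refine eq_zero_of_dvd_of_natDegree_lt (hcoprime.mul_dvd hX hXa) (hdeg.trans_eq ?_)
  simp [natDegree_mul, X_sub_C_ne_zero]

variable [CharZero K]

theorem X_sub_C_pow_dvd_of_forall_isRoot_iterate_derivative {P : K[X]} {t : K} {n : ℕ}
    (h : ∀ m < n, (derivative^[m] P).IsRoot t) : (X - C t) ^ n ∣ P := by
  rcases eq_or_ne P 0 with rfl | hP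
  · exact dvd_zero _
  cases n with
  | zero => simp
  | succ n =>
    exact (le_rootMultiplicity_iff hP).1 ((lt_rootMultiplicity_iff_isRoot_iterate_derivative hP).2
      fun m hm => h m (Nat.lt_succ_of_le hm))

theorem eval_one_iterate_derivative_div_factorial_mul_X_pow (c : K) {m n : ℕ} (h : m ≤ n) :
    (derivative^[m] (C (c / n.factorial) * X ^ n)).eval 1 = c / (n - m).factorial := by
  have hn : (n.factorial : K) = (n - m).factorial * n.descFactorial m := by
    exact_mod_cast (Nat.factorial_mul_descFactorial h).symm
  have hdesc : (n.descFactorial m : K) ≠ 0 := by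
    exact_mod_cast (Nat.descFactorial_pos.2 h).ne'
  rw [iterate_derivative_C_mul, iterate_derivative_X_pow_eq_natCast_mul]
  simp only [eval_mul, eval_C, eval_natCast, eval_pow, eval_X, one_pow, mul_one]
  rw [hn, div_mul_eq_mul_div, mul_div_mul_right _ _ hdesc]

/- The sums are the derivatives at `1` of a polynomial of degree at most `2 (r - 1) + s` that is
divisible by `X ^ (r - 1 + s)`. -/
theorem eq_zero_of_forall_sum_div_factorial_eq_zero {r : ℕ} (s : ℕ) {u : Fin r → K}
    (h : ∀ b : Fin r, ∑ a : Fin r, u a / ((a : ℕ) + b + s).factorial = 0) : u = 0 := by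
  obtain _ | n := r
  · exact Subsingleton.elim _ _
  let P : K[X] := ∑ a : Fin (n + 1), C (u a / ((a : ℕ) + n + s).factorial) * X ^ ((a : ℕ) + n + s)
  have hcoeff (a : Fin (n + 1)) : P.coeff (a + n + s) = u a / ((a : ℕ) + n + s).factorial := by
    simp [P, finsetSum_coeff, coeff_X_pow, ← Fin.ext_iff]
  have hX : X ^ (n + s) ∣ P := Finset.dvd_sum fun a _ =>
    (pow_dvd_pow X (by omega)).mul_left _
  have hXsub : (X - C 1) ^ (n + 1) ∣ P := by
    refine X_sub_C_pow_dvd_of_forall_isRoot_iterate_derivative fun m hm => ?_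
    rw [IsRoot.def, iterate_derivative_sum, eval_finsetSum, ← h ⟨n - m, by omega⟩]
    refine Finset.sum_congr rfl fun a _ => ?_
    rw [eval_one_iterate_derivative_div_factorial_mul_X_pow _ (by omega)]
    congr 3
    dsimp only
    omega
  have hdeg : P.natDegree < (n + s) + (n + 1) :=
    Nat.lt_of_le_of_lt (m := 2 * n + s) (natDegree_sum_le_of_forall_le _ _ fun a _ =>
      (natDegree_C_mul_X_pow_le _ _).trans (by omega)) (by omega)
  have hP : P = 0 := eq_zero_of_pow_dvd_of_natDegree_lt one_ne_zero hX hXsub hdeg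
  funext a
  have ha := hcoeff a
  rw [hP, coeff_zero, eq_comm, div_eq_zero_iff] at ha
  exact ha.resolve_right (Nat.cast_ne_zero.2 (Nat.factorial_ne_zero _))

end InverseFactorialHankel

section DiscontinuousTransformation

theorem contDiffAt_of_eventually_leftInverse {E F : Type*} [NormedAddCommGroup E]
    [NormedSpace ℝ E] [CompleteSpace E] [NormedAddCommGroup F] [NormedSpace ℝ F]
    {n : WithTop ℕ∞} (hn : n ≠ 0) {f : E → F} {g : F → E} {f' : E ≃L[ℝ] F} {x : E}
    (hf : ContDiffAt ℝ n f x) (hf' : HasFDerivAt f (f' : E →L[ℝ] F) x)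
    (hgf : ∀ᶠ y in 𝓝 x, g (f y) = y) : ContDiffAt ℝ n g (f x) := by
  have hloc := hf.to_localInverse hf' hn
  refine hloc.congr_of_eventuallyEq ?_
  have hright := (hf.hasStrictFDerivAt' hf' hn).eventually_right_inverse
  have htendsto : Tendsto (hf.localInverse hf' hn) (𝓝 (f x)) (𝓝 x) := by
    simpa [hf.localInverse_apply_image hf' hn] using hloc.continuousAt.tendsto
  filter_upwards [hright, htendsto.eventually hgf] with z hz hgz
  exact (congrArg g hz).symm.trans hgz

variable {r : ℕ}

/-- The coordinates `w₃, …, wₙ`, in which `fwInv` is a triangular array of power series. -/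
def tail (w : Fin (r + 2) → ℝ) : Fin r → ℝ := fun i => w i.succ.succ

/-- The sum `∑ᵢ x^{i+m} uᵢ / (i+m)!` that makes up the rows of `fwInv`. -/
noncomputable def chainSum (m : ℕ) (x : ℝ) (u : Fin r → ℝ) : ℝ :=
  ∑ i : Fin r, 1 / (Nat.factorial ((i : ℕ) + m) : ℝ) * x ^ ((i : ℕ) + m) * u i

theorem chainSum_sub (m : ℕ) (x : ℝ) (u v : Fin r → ℝ) :
    chainSum m x (u - v) = chainSum m x u - chainSum m x v := by
  simp only [chainSum, Pi.sub_apply, mul_sub, Finset.sum_sub_distrib]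

theorem chainSum_zero (m : ℕ) (x : ℝ) : chainSum m x (0 : Fin r → ℝ) = 0 := by
  simp [chainSum]

theorem eq_zero_of_forall_chainSum_eq_zero {x : ℝ} (hx : x ≠ 0) (s : ℕ) {u : Fin r → ℝ}
    (h : ∀ b : Fin r, chainSum (b + s) x u = 0) : u = 0 := by
  have hu : (fun a : Fin r => x ^ (a : ℕ) * u a) = 0 := by
    refine eq_zero_of_forall_sum_div_factorial_eq_zero s fun b => ?_
    refine (mul_eq_zero_iff_left (pow_ne_zero ((b : ℕ) + s) hx)).1 ?_
    rw [← h b, chainSum, Finset.mul_sum]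
    refine Finset.sum_congr rfl fun a _ => ?_
    rw [add_assoc]
    ring
  funext a
  exact (mul_eq_zero.1 (congrFun hu a)).resolve_left (pow_ne_zero _ hx)

theorem hasDerivAt_chainSum {m : ℕ} {x : ℝ → ℝ} {u : ℝ → Fin r → ℝ} {x' t : ℝ} {u' : Fin r → ℝ}
    (hx : HasDerivAt x x' t) (hu : HasDerivAt u u' t) :
    HasDerivAt (fun s => chainSum (m + 1) (x s) (u s))
      (x' * chainSum m (x t) (u t) + chainSum (m + 1) (x t) u') t := by
  simp only [chainSum]
  refine (HasDerivAt.fun_sum fun i _ =>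
    ((hx.pow _).const_mul _).mul (hasDerivAt_pi.1 hu i)).congr_deriv ?_
  rw [Finset.mul_sum, ← Finset.sum_add_distrib]
  refine Finset.sum_congr rfl fun i _ => ?_
  rw [← add_assoc, Nat.factorial_succ, Nat.add_sub_cancel]
  push_cast
  simp only [Pi.pow_apply]
  field_simp

theorem fwInv_one (w : Fin (r + 2) → ℝ) :
    fwInv w 1 = w 0 * w 1 + chainSum 1 (w 0) (tail w) := rfl

theorem fwInv_succ_succ (w : Fin (r + 2) → ℝ) (j : Fin r) :
    fwInv w j.succ.succ = chainSum (j + 2) (w 0) (tail w) := rfl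

theorem fwInv_castSucc_succ_mul {w : Fin (r + 2) → ℝ} {a : ℝ} (h : w 1 * a = 0) (j : Fin r) :
    fwInv w j.castSucc.succ * a = a * chainSum (j + 1) (w 0) (tail w) := by
  obtain ⟨_ | j, hj⟩ := j
  · calc fwInv w 1 * a = (w 0 * w 1 + chainSum 1 (w 0) (tail w)) * a := by rw [fwInv_one]
      _ = a * chainSum 1 (w 0) (tail w) := by linear_combination w 0 * h
  · exact mul_comm _ _

theorem contDiff_fwInv {n : WithTop ℕ∞} : ContDiff ℝ n (fwInv : (Fin (r + 2) → ℝ) → _) := by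
  rw [contDiff_pi]
  intro j
  unfold fwInv
  split_ifs <;> fun_prop

theorem eq_of_coords_eq {w w' : Fin (r + 2) → ℝ} (h0 : w 0 = w' 0) (h1 : w 1 = w' 1)
    (htail : tail w = tail w') : w = w' := by
  funext j
  exact Fin.cases h0 (Fin.cases h1 (congrFun htail)) j

theorem eq_of_fwInv_eq {w w' : Fin (r + 2) → ℝ} (hw : w 0 ≠ 0) (h : fwInv w = fwInv w') :
    w = w' := by
  have h0 : w 0 = w' 0 := congrFun h 0
  have htail : tail w = tail w' := by
    refine sub_eq_zero.1 (eq_zero_of_forall_chainSum_eq_zero hw 2 fun b => ?_)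
    have hb := congrFun h b.succ.succ
    rw [fwInv_succ_succ, fwInv_succ_succ, ← h0] at hb
    rw [chainSum_sub, hb, sub_self]
  have h1 : w 1 = w' 1 := by
    have h := congrFun h 1
    rw [fwInv_one, fwInv_one, ← h0, htail, add_left_inj] at h
    exact mul_left_cancel₀ hw h
  exact eq_of_coords_eq h0 h1 htail

theorem fw_fwInv {w : Fin (r + 2) → ℝ} (hw : w 0 ≠ 0) : fw (fwInv w) = w :=
  (eq_of_fwInv_eq hw (Function.invFun_eq ⟨w, rfl⟩).symm).symm

theorem hasFDerivAt_fwInv (w : Fin (r + 2) → ℝ) : HasFDerivAt fwInv (fderiv ℝ fwInv w) w :=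
  (contDiff_fwInv.differentiable one_ne_zero w).hasFDerivAt

section Derivative

variable (w ξ : Fin (r + 2) → ℝ)

theorem hasDerivAt_add_smul : HasDerivAt (fun s : ℝ => w + s • ξ) ξ 0 := by
  simpa using ((hasDerivAt_id (0 : ℝ)).smul_const ξ).const_add w

theorem hasDerivAt_fwInv_add_smul (j : Fin (r + 2)) :
    HasDerivAt (fun s : ℝ => fwInv (w + s • ξ) j) (fderiv ℝ fwInv w ξ j) 0 :=
  hasDerivAt_pi.1 ((hasFDerivAt_fwInv w).hasLineDerivAt ξ) j

theorem hasDerivAt_chainSum_add_smul (m : ℕ) :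
    HasDerivAt (fun s : ℝ => chainSum (m + 1) ((w + s • ξ) 0) (tail (w + s • ξ)))
      (ξ 0 * chainSum m (w 0) (tail w) + chainSum (m + 1) (w 0) (tail ξ)) 0 := by
  have hline := hasDerivAt_pi.1 (hasDerivAt_add_smul w ξ)
  simpa using hasDerivAt_chainSum (m := m) (hline 0)
    (u := fun s => tail (w + s • ξ)) (u' := tail ξ) (hasDerivAt_pi.2 fun i => hline i.succ.succ)

theorem fderiv_fwInv_zero : fderiv ℝ fwInv w ξ 0 = ξ 0 :=
  (hasDerivAt_fwInv_add_smul w ξ 0).unique (hasDerivAt_pi.1 (hasDerivAt_add_smul w ξ) 0)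

theorem fderiv_fwInv_one : fderiv ℝ fwInv w ξ 1 = ξ 0 * w 1 + w 0 * ξ 1 +
    (ξ 0 * chainSum 0 (w 0) (tail w) + chainSum 1 (w 0) (tail ξ)) := by
  have hline := hasDerivAt_pi.1 (hasDerivAt_add_smul w ξ)
  simpa using (hasDerivAt_fwInv_add_smul w ξ 1).unique
    (((hline 0).mul (hline 1)).add (hasDerivAt_chainSum_add_smul w ξ 0))

theorem fderiv_fwInv_succ_succ (j : Fin r) : fderiv ℝ fwInv w ξ j.succ.succ =
    ξ 0 * chainSum (j + 1) (w 0) (tail w) + chainSum (j + 2) (w 0) (tail ξ) :=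
  (hasDerivAt_fwInv_add_smul w ξ j.succ.succ).unique (hasDerivAt_chainSum_add_smul w ξ (j + 1))

end Derivative

theorem fderiv_fwInv_bijective {w : Fin (r + 2) → ℝ} (hw : w 0 ≠ 0) :
    Function.Bijective (fderiv ℝ fwInv w) := by
  have hinj : Function.Injective (fderiv ℝ fwInv w) := by
    refine (injective_iff_map_eq_zero _).2 fun ξ hξ => ?_
    have h0 : ξ 0 = 0 := by rw [← fderiv_fwInv_zero w ξ, hξ, Pi.zero_apply]
    have htail : tail ξ = 0 := eq_zero_of_forall_chainSum_eq_zero hw 2 fun b => by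
      simpa [hξ, h0] using (fderiv_fwInv_succ_succ w ξ b).symm
    have h1 : ξ 1 = 0 := by
      simpa [hξ, h0, htail, chainSum_zero, hw] using fderiv_fwInv_one w ξ
    exact eq_of_coords_eq h0 h1 htail
  exact ⟨hinj, (LinearMap.injective_iff_surjective (f := (fderiv ℝ fwInv w).toLinearMap)).1 hinj⟩

theorem eventually_fw_fwInv {w : Fin (r + 2) → ℝ} (hw : w 0 ≠ 0) :
    ∀ᶠ y in 𝓝 w, fw (fwInv y) = y :=
  ((continuous_apply 0).continuousAt.eventually_ne hw).mono fun _ => fw_fwInv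

theorem contDiffAt_fw {n : WithTop ℕ∞} (hn : n ≠ 0) {w : Fin (r + 2) → ℝ} (hw : w 0 ≠ 0) :
    ContDiffAt ℝ n fw (fwInv w) := by
  have hbij := fderiv_fwInv_bijective hw
  exact contDiffAt_of_eventually_leftInverse hn contDiff_fwInv.contDiffAt
    (f' := ContinuousLinearEquiv.ofBijective (fderiv ℝ fwInv w)
      (LinearMap.ker_eq_bot.2 hbij.1) (LinearMap.range_eq_top.2 hbij.2))
    ((hasFDerivAt_fwInv w).congr_fderiv (ContinuousLinearEquiv.coe_ofBijective ..).symm)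
    (eventually_fw_fwInv hw)

theorem fderiv_fwInv_fderiv_fw {w : Fin (r + 2) → ℝ} (hw : w 0 ≠ 0) (ζ : Fin (r + 2) → ℝ) :
    fderiv ℝ fwInv w (fderiv ℝ fw (fwInv w) ζ) = ζ := by
  have hfw := ((contDiffAt_fw one_ne_zero hw).differentiableAt one_ne_zero).hasFDerivAt
  have hleft := ((hfw.comp w (hasFDerivAt_fwInv w)).congr_of_eventuallyEq
    ((eventually_fw_fwInv hw).mono fun y hy => hy.symm)).unique (hasFDerivAt_id w)
  obtain ⟨ξ, rfl⟩ := (fderiv_fwInv_bijective hw).2 ζ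
  exact congrArg (fderiv ℝ fwInv w) (DFunLike.congr_fun hleft ξ)

theorem tail_eq_zero_of_chained {w ξ : Fin (r + 2) → ℝ} (hw : w 0 ≠ 0)
    (h : ∀ j : Fin r, fderiv ℝ fwInv w ξ j.succ.succ = fwInv w j.castSucc.succ * ξ 0)
    (h1 : w 1 * ξ 0 = 0) : tail ξ = 0 :=
  eq_zero_of_forall_chainSum_eq_zero hw 2 fun j => by
    simpa [fderiv_fwInv_succ_succ, fwInv_castSucc_succ_mul h1] using h j

theorem fwInv_eq_zero {w : Fin (r + 2) → ℝ} (hw : w 0 = 0) : fwInv w = 0 := by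
  have hsum (m : ℕ) : chainSum (m + 1) (w 0) (tail w) = 0 := by
    simp [chainSum, hw, ← add_assoc]
  refine eq_of_coords_eq hw ?_ (funext fun j => ?_)
  · rw [fwInv_one, hsum 0, hw, zero_mul, add_zero, Pi.zero_apply]
  · exact (fwInv_succ_succ w j).trans (hsum (j + 1))

theorem tendsto_fwInv_zero {α : Type*} {l : Filter α} {w : α → Fin (r + 2) → ℝ}
    {K : Set (Fin (r + 2) → ℝ)} (hK : IsCompact K) (hw : ∀ᶠ t in l, w t ∈ K)
    (h0 : Tendsto (fun t => w t 0) l (𝓝 0)) : Tendsto (fun t => fwInv (w t)) l (𝓝 0) := by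
  refine tendsto_comp_of_forall_mapClusterPt hK hw (contDiff_fwInv (n := 0)).continuous
    fun p _ hp => fwInv_eq_zero ?_
  have hp0 : MapClusterPt (p 0) l fun t => w t 0 :=
    hp.continuousAt_comp (continuous_apply 0).continuousAt
  exact eq_of_nhds_neBot (ClusterPt.mono hp0 h0)

end DiscontinuousTransformation

section MatrixSmoothness

variable {𝕜 E : Type*} [NontriviallyNormedField 𝕜] [NormedAddCommGroup E] [NormedSpace 𝕜 E]
  {a b c : Type*} [Fintype b] {n : WithTop ℕ∞} {x : E}

theorem contDiffAt_matrix_mul {A : E → Matrix a b 𝕜} {B : E → Matrix b c 𝕜}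
    (hA : ∀ i j, ContDiffAt 𝕜 n (fun y => A y i j) x)
    (hB : ∀ i j, ContDiffAt 𝕜 n (fun y => B y i j) x) (i : a) (j : c) :
    ContDiffAt 𝕜 n (fun y => (A y * B y) i j) x := by
  simp only [Matrix.mul_apply]
  exact ContDiffAt.sum fun k _ => (hA i k).mul (hB k j)

theorem contDiffAt_dotProduct {u v : E → b → 𝕜} (hu : ContDiffAt 𝕜 n u x)
    (hv : ContDiffAt 𝕜 n v x) : ContDiffAt 𝕜 n (fun y => u y ⬝ᵥ v y) x :=
  ContDiffAt.sum fun k _ => (contDiffAt_pi.1 hu k).mul (contDiffAt_pi.1 hv k)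

theorem contDiffAt_matrix_mulVec [Fintype a] {A : E → Matrix a b 𝕜} {v : E → b → 𝕜}
    (hA : ∀ i j, ContDiffAt 𝕜 n (fun y => A y i j) x) (hv : ContDiffAt 𝕜 n v x) :
    ContDiffAt 𝕜 n (fun y => A y *ᵥ v y) x :=
  contDiffAt_pi.2 fun i => contDiffAt_dotProduct (contDiffAt_pi.2 (hA i)) hv

variable [DecidableEq b] {A : E → Matrix b b 𝕜}

theorem contDiffAt_matrix_det (hA : ∀ i j, ContDiffAt 𝕜 n (fun y => A y i j) x) :
    ContDiffAt 𝕜 n (fun y => (A y).det) x := by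
  simp only [Matrix.det_apply']
  exact ContDiffAt.sum fun σ _ => contDiffAt_const.mul (contDiffAt_prod fun i _ => hA _ _)

theorem contDiffAt_matrix_inv (hA : ∀ i j, ContDiffAt 𝕜 n (fun y => A y i j) x)
    (hdet : (A x).det ≠ 0) (i j : b) : ContDiffAt 𝕜 n (fun y => (A y)⁻¹ i j) x := by
  simp only [Matrix.inv_def, Ring.inverse_eq_inv', Matrix.smul_apply, smul_eq_mul,
    Matrix.adjugate_apply]
  refine ((contDiffAt_matrix_det hA).inv hdet).mul (contDiffAt_matrix_det fun k m => ?_)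
  obtain rfl | h := eq_or_ne k j
  · simpa only [Matrix.updateRow_self] using contDiffAt_const
  · simpa only [Matrix.updateRow_ne h] using hA k m

end MatrixSmoothness

section Gradients

variable {E : Type*} [NormedAddCommGroup E] [NormedSpace ℝ E] {m l : ℕ}

theorem jacobian_mulVec (g : (Fin m → ℝ) → (Fin l → ℝ)) (x v : Fin m → ℝ) :
    jacobian g x *ᵥ v = fderiv ℝ g x v := by
  funext i
  conv_rhs => rw [pi_eq_sum_univ' v, map_sum]
  simp [Matrix.mulVec, dotProduct, jacobian, mul_comm]

theorem grad_dotProduct (g : (Fin m → ℝ) → ℝ) (x v : Fin m → ℝ) :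
    grad g x ⬝ᵥ v = fderiv ℝ g x v := by
  conv_rhs => rw [pi_eq_sum_univ' v, map_sum]
  simp [dotProduct, grad, mul_comm]

theorem grad_add {f g : (Fin m → ℝ) → ℝ} {x : Fin m → ℝ} (hf : DifferentiableAt ℝ f x)
    (hg : DifferentiableAt ℝ g x) : grad (fun y => f y + g y) x = grad f x + grad g x := by
  funext i
  simp only [grad, fderiv_fun_add hf hg, Pi.add_apply, _root_.add_apply]

theorem grad_add_const (f : (Fin m → ℝ) → ℝ) (c : ℝ) (x : Fin m → ℝ) :
    grad (fun y => f y + c) x = grad f x := by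
  funext i
  rw [grad, fderiv_add_const, grad]

theorem contDiffAt_jacobian {k n : WithTop ℕ∞} {g : E → (Fin m → ℝ) → (Fin l → ℝ)}
    {q : E → (Fin m → ℝ)} {x : E} (hg : ContDiffAt ℝ n (Function.uncurry g) (x, q x))
    (hq : ContDiffAt ℝ k q x) (hkn : k + 1 ≤ n) (i : Fin l) (j : Fin m) :
    ContDiffAt ℝ k (fun y => jacobian (g y) (q y) i j) x :=
  contDiffAt_pi.1 ((hg.fderiv hq hkn).clm_apply contDiffAt_const) i

theorem contDiffAt_grad {k n : WithTop ℕ∞} {g : E → (Fin m → ℝ) → ℝ} {q : E → (Fin m → ℝ)}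
    {x : E} (hg : ContDiffAt ℝ n (Function.uncurry g) (x, q x)) (hq : ContDiffAt ℝ k q x)
    (hkn : k + 1 ≤ n) : ContDiffAt ℝ k (fun y => grad (g y) (q y)) x :=
  contDiffAt_pi.2 fun _ => (hg.fderiv hq hkn).clm_apply contDiffAt_const

theorem fderiv_uncurry_apply {F : (Fin m → ℝ) → (Fin l → ℝ) → ℝ} {w : Fin m → ℝ}
    {p : Fin l → ℝ} (hF : DifferentiableAt ℝ (Function.uncurry F) (w, p)) (a : Fin m → ℝ)
    (b : Fin l → ℝ) :
    fderiv ℝ (Function.uncurry F) (w, p) (a, b) =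
      grad (fun w' => F w' p) w ⬝ᵥ a + grad (fun p' => F w p') p ⬝ᵥ b := by
  have hw : HasFDerivAt (fun w' => F w' p) _ w :=
    hF.hasFDerivAt.comp (f := fun w' => (w', p)) w (hasFDerivAt_prodMk_left w p)
  have hp : HasFDerivAt (fun p' => F w p') _ p :=
    hF.hasFDerivAt.comp (f := fun p' => (w, p')) p (hasFDerivAt_prodMk_right w p)
  rw [grad_dotProduct, grad_dotProduct, hw.fderiv, hp.fderiv]
  simp [← map_add]

theorem contDiff_quadratic {n : WithTop ℕ∞} (A : Matrix (Fin m) (Fin m) ℝ) :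
    ContDiff ℝ n fun p : Fin m → ℝ => 1 / 2 * (p ⬝ᵥ (A *ᵥ p)) :=
  contDiff_iff_contDiffAt.2 fun _ => contDiffAt_const.mul
    (contDiffAt_dotProduct contDiffAt_id
      (contDiffAt_matrix_mulVec (fun _ _ => contDiffAt_const) contDiffAt_id))

theorem grad_quadratic {A : Matrix (Fin m) (Fin m) ℝ} (hA : A.IsSymm) (p : Fin m → ℝ) :
    grad (fun p : Fin m → ℝ => 1 / 2 * (p ⬝ᵥ (A *ᵥ p))) p = A *ᵥ p := by
  have himage (i : Fin m) := ((ContinuousLinearMap.proj (R := ℝ) i).comp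
    A.mulVecLin.toContinuousLinearMap).hasFDerivAt (x := p)
  have hquad := (HasFDerivAt.fun_sum (u := Finset.univ)
    fun i _ => (hasFDerivAt_apply (𝕜 := ℝ) i p).mul (himage i)).const_mul (1 / 2 : ℝ)
  funext j
  calc grad (fun p : Fin m → ℝ => 1 / 2 * (p ⬝ᵥ (A *ᵥ p))) p j
      = 1 / 2 * ((p ᵥ* A) j + (A *ᵥ p) j) := by
        refine (DFunLike.congr_fun hquad.fderiv (Pi.single j 1)).trans ?_
        simp [mul_add, Finset.sum_add_distrib, Matrix.vecMul, dotProduct, Pi.single_apply]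
    _ = (A *ᵥ p) j := by
        rw [← Matrix.mulVec_transpose, hA]
        ring

end Gradients

section Forms

theorem dotProduct_mulVec_self_eq_zero {ι R : Type*} [Fintype ι] [CommRing R] [IsDomain R]
    [CharZero R] {A : Matrix ι ι R} (hA : Aᵀ = -A) (v : ι → R) : v ⬝ᵥ (A *ᵥ v) = 0 := by
  refine self_eq_neg.1 ?_
  rw [← dotProduct_neg, ← Matrix.neg_mulVec, ← hA, Matrix.dotProduct_transpose_mulVec]

theorem mulVec_injective_of_rank_eq_card {ι κ K : Type*} [Fintype κ] [Field K]
    {A : Matrix ι κ K} (hA : A.rank = Fintype.card κ) : Function.Injective A.mulVec := by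
  rw [Matrix.mulVec_injective_iff, linearIndependent_iff_card_eq_finrank_span, ← hA,
    Matrix.rank_eq_finrank_span_cols, Set.finrank]

theorem sq_apply_le_diag_mul_inv {ι : Type*} [Fintype ι] [DecidableEq ι] {A : Matrix ι ι ℝ}
    (hA : A.PosDef) (p : ι → ℝ) (i : ι) : p i ^ 2 ≤ A i i * (p ⬝ᵥ (A⁻¹ *ᵥ p)) := by
  have hsymm : LinearMap.IsSymm (Matrix.toBilin' A⁻¹) := ⟨fun x y => by
    simp only [Matrix.toBilin'_apply', RingHom.id_apply]
    rw [← Matrix.dotProduct_transpose_mulVec, ← Matrix.conjTranspose_eq_transpose_of_trivial,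
      hA.inv.1]⟩
  have hnonneg (v : ι → ℝ) : 0 ≤ Matrix.toBilin' A⁻¹ v v := by
    simpa only [Matrix.toBilin'_apply', star_trivial]
      using hA.inv.posSemidef.dotProduct_mulVec_nonneg v
  have hdual : A⁻¹ *ᵥ A.col i = Pi.single i 1 := by
    rw [← Matrix.mulVec_single_one, Matrix.mulVec_mulVec,
      Matrix.nonsing_inv_mul _ hA.det_pos.ne'.isUnit, Matrix.one_mulVec]
  have hcauchy := LinearMap.BilinForm.apply_sq_le_of_symm _ hnonneg hsymm p (A.col i)
  simpa only [Matrix.toBilin'_apply', hdual, dotProduct_single_one, Matrix.col_apply, mul_comm]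
    using hcauchy

theorem mul_sq_le_dotProduct_diagonal {ι R : Type*} [Fintype ι] [DecidableEq ι] [CommRing R]
    [LinearOrder R] [IsStrictOrderedRing R] {l : ι → R} (hl : ∀ i, 0 ≤ l i) (w : ι → R) (i : ι) :
    l i * w i ^ 2 ≤ w ⬝ᵥ (Matrix.diagonal l *ᵥ w) := by
  have hsum : w ⬝ᵥ (Matrix.diagonal l *ᵥ w) = ∑ j, l j * w j ^ 2 := by
    simp only [dotProduct, Matrix.mulVec_diagonal]
    exact Finset.sum_congr rfl fun j _ => by ring
  rw [hsum]
  exact Finset.single_le_sum (f := fun j => l j * w j ^ 2)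
    (fun j _ => mul_nonneg (hl j) (sq_nonneg _)) (Finset.mem_univ i)

end Forms

theorem NonholonomicSystem.contDiffAt_M₀ {r : ℕ} (S : NonholonomicSystem r) {E : Type*}
    [NormedAddCommGroup E] [NormedSpace ℝ E] {x : E} {q : E → Fin (r + 2) → ℝ}
    (hq : ContDiffAt ℝ ∞ q x) (hΩ : q x ∈ S.Ω) (i j : Fin (r + 2)) :
    ContDiffAt ℝ ∞ (fun y => S.M₀ (q y) i j) x :=
  ((S.contDiffOn_M₀ i j).contDiffAt (S.isOpen_Ω.mem_nhds hΩ)).comp x hq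

/-- The state space of the pairs `(w, p)`. -/
abbrev State (r : ℕ) : Type := (Fin (r + 2) → ℝ) × (Fin 2 → ℝ)

/-- The singular coordinate `w₁` of a state. -/
def firstCoord (r : ℕ) : State r →L[ℝ] ℝ :=
  (ContinuousLinearMap.proj 0).comp (ContinuousLinearMap.fst ℝ _ _)

namespace Coordinates

variable {r : ℕ} {S : NonholonomicSystem r} (R : Coordinates S)

theorem fz_symm_mem (z : Fin (r + 2) → ℝ) : R.fz.symm z ∈ S.Ω :=
  R.source_fz ▸ R.fz.map_target (R.target_fz ▸ mem_univ z)

section ReducedSystem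

variable {q : Fin (r + 2) → ℝ}

theorem Q_mulVec_injective (hq : q ∈ S.Ω) : Function.Injective (R.Q q).mulVec :=
  mulVec_injective_of_rank_eq_card (by rw [R.rank_Q q hq, Fintype.card_fin])

theorem posDef_M (hq : q ∈ S.Ω) : (R.M q).PosDef := by
  have h := (S.posDef_M₀ q hq).conjTranspose_mul_mul_same (R.Q_mulVec_injective hq)
  rwa [Matrix.conjTranspose_eq_transpose_of_trivial] at h

theorem posSemidef_D (hq : q ∈ S.Ω) (p : Fin 2 → ℝ) : (R.D p q).PosSemidef := by
  have h := (S.posSemidef_D₀ (R.p₀ p q) q hq).conjTranspose_mul_mul_same (R.Q q)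
  rwa [Matrix.conjTranspose_eq_transpose_of_trivial] at h

theorem transpose_C (p : Fin 2 → ℝ) (q : Fin (r + 2) → ℝ) : (R.C p q)ᵀ = -R.C p q := by
  simp only [C, Matrix.transpose_mul, Matrix.transpose_sub, Matrix.transpose_transpose,
    Matrix.mul_sub, Matrix.sub_mul, ← Matrix.mul_assoc, neg_sub]

theorem isUnit_det_G (hq : q ∈ S.Ω) : IsUnit (R.G q).det := by
  have hfull : Function.Injective ((Matrix.fromCols (S.G₀ q) (S.Gc q))ᵀ).mulVec :=
    mulVec_injective_of_rank_eq_card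
      (by rw [Matrix.rank_transpose, S.rank_G₀_Gc q hq, Fintype.card_fin])
  have hannihilates : (S.Gc q)ᵀ * R.Q q = 0 := by
    rw [← Matrix.transpose_transpose (R.Q q), ← Matrix.transpose_mul, R.annihilates q hq,
      Matrix.transpose_zero]
  have hstack (y : Fin 2 → ℝ) : (Matrix.fromCols (S.G₀ q) (S.Gc q))ᵀ *ᵥ (R.Q q *ᵥ y) =
      Sum.elim ((R.G q)ᵀ *ᵥ y) 0 := by
    rw [Matrix.transpose_fromCols, Matrix.fromRows_mulVec, Matrix.mulVec_mulVec,
      Matrix.mulVec_mulVec, hannihilates, Matrix.zero_mulVec, G, Matrix.transpose_mul,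
      Matrix.transpose_transpose]
  rw [← Matrix.isUnit_iff_isUnit_det, ← Matrix.isUnit_transpose,
    ← Matrix.mulVec_injective_iff_isUnit]
  exact fun y y' hy => R.Q_mulVec_injective hq <| hfull <| by
    rw [hstack, hstack, hy]

end ReducedSystem

section Smoothness

variable {E : Type*} [NormedAddCommGroup E] [NormedSpace ℝ E] {x : E}
  {q w : E → Fin (r + 2) → ℝ} {p : E → Fin 2 → ℝ}

theorem contDiffAt_Q (hq : ContDiffAt ℝ ∞ q x) (hΩ : q x ∈ S.Ω) (i : Fin (r + 2)) (j : Fin 2) :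
    ContDiffAt ℝ ∞ (fun y => R.Q (q y) i j) x :=
  ((R.contDiffOn_Q i j).contDiffAt (S.isOpen_Ω.mem_nhds hΩ)).comp x hq

theorem contDiffAt_M (hq : ContDiffAt ℝ ∞ q x) (hΩ : q x ∈ S.Ω) (i j : Fin 2) :
    ContDiffAt ℝ ∞ (fun y => R.M (q y) i j) x := by
  have hQ := R.contDiffAt_Q hq hΩ
  exact contDiffAt_matrix_mul (contDiffAt_matrix_mul (fun i j => hQ j i)
    (S.contDiffAt_M₀ hq hΩ)) hQ i j

theorem contDiffAt_p₀ (hp : ContDiffAt ℝ ∞ p x) (hq : ContDiffAt ℝ ∞ q x) (hΩ : q x ∈ S.Ω) :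
    ContDiffAt ℝ ∞ (fun y => R.p₀ (p y) (q y)) x := by
  have hMinv := contDiffAt_matrix_inv (R.contDiffAt_M hq hΩ) (R.posDef_M hΩ).det_pos.ne'
  exact contDiffAt_matrix_mulVec
    (contDiffAt_matrix_mul (contDiffAt_matrix_mul (S.contDiffAt_M₀ hq hΩ) (R.contDiffAt_Q hq hΩ))
      hMinv) hp

theorem contDiffAt_D (hp : ContDiffAt ℝ ∞ p x) (hq : ContDiffAt ℝ ∞ q x) (hΩ : q x ∈ S.Ω)
    (i j : Fin 2) : ContDiffAt ℝ ∞ (fun y => R.D (p y) (q y) i j) x := by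
  have hD₀ (i j) : ContDiffAt ℝ ∞ (fun y => S.D₀ (R.p₀ (p y) (q y)) (q y) i j) x :=
    ((S.contDiffOn_D₀ i j).contDiffAt
      ((isOpen_univ.prod S.isOpen_Ω).mem_nhds ⟨mem_univ _, hΩ⟩)).comp
      (f := fun y => (R.p₀ (p y) (q y), q y)) x ((R.contDiffAt_p₀ hp hq hΩ).prodMk hq)
  have hQ := R.contDiffAt_Q hq hΩ
  exact contDiffAt_matrix_mul (contDiffAt_matrix_mul (fun i j => hQ j i) hD₀) hQ i j

theorem contDiffAt_C (hp : ContDiffAt ℝ ∞ p x) (hq : ContDiffAt ℝ ∞ q x) (hΩ : q x ∈ S.Ω)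
    (i j : Fin 2) : ContDiffAt ℝ ∞ (fun y => R.C (p y) (q y) i j) x := by
  have hJ := contDiffAt_jacobian (g := fun y => R.p₀ (p y)) (x := x)
    (R.contDiffAt_p₀ (hp.comp (x, q x) contDiffAt_fst) contDiffAt_snd hΩ) hq le_rfl
  have hQ := R.contDiffAt_Q hq hΩ
  exact contDiffAt_matrix_mul (contDiffAt_matrix_mul (fun i j => hQ j i)
    fun i j => (hJ j i).sub (hJ i j)) hQ i j

/-- The configuration `q = f_z⁻¹(f_w⁻¹(w))`, so that `M_w`, `C_w`, `D_w`, `G_w` and `V_w` are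
`M`, `C`, `D`, `G` and `V` evaluated at `config w`. -/
noncomputable def config (w : Fin (r + 2) → ℝ) : Fin (r + 2) → ℝ := R.fz.symm (fwInv w)

theorem config_mem (w : Fin (r + 2) → ℝ) : R.config w ∈ S.Ω := R.fz_symm_mem _

theorem contDiff_config : ContDiff ℝ ∞ R.config := R.contDiff_fz_symm.comp contDiff_fwInv

theorem contDiffAt_fz {q : Fin (r + 2) → ℝ} (hΩ : q ∈ S.Ω) : ContDiffAt ℝ ∞ R.fz q :=
  R.contDiffOn_fz.contDiffAt (S.isOpen_Ω.mem_nhds hΩ)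

theorem contDiff_Mw (i j : Fin 2) : ContDiff ℝ ∞ fun w => R.Mw w i j :=
  contDiff_iff_contDiffAt.2 fun w =>
    R.contDiffAt_M R.contDiff_config.contDiffAt (R.config_mem w) i j

theorem contDiff_Vw : ContDiff ℝ ∞ R.Vw :=
  S.contDiffOn_V.comp_contDiff R.contDiff_config R.config_mem

theorem contDiff_Qz (i : Fin (r + 2)) (j : Fin 2) : ContDiff ℝ ∞ fun z => R.Qz z i j := by
  refine contDiff_iff_contDiffAt.2 fun z => ?_
  have hsymm := R.contDiff_fz_symm.contDiffAt (x := z)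
  have hΩ := R.fz_symm_mem z
  exact contDiffAt_matrix_mul (contDiffAt_jacobian (g := fun _ => R.fz)
    ((R.contDiffAt_fz hΩ).comp (z, R.fz.symm z) contDiffAt_snd) hsymm le_rfl)
    (R.contDiffAt_Q hsymm hΩ) i j

theorem contDiffAt_Qw (hw : ContDiffAt ℝ ∞ w x) (hx : w x 0 ≠ 0) (i : Fin (r + 2)) (j : Fin 2) :
    ContDiffAt ℝ ∞ (fun y => R.Qw (w y) i j) x := by
  have hz : ContDiffAt ℝ ∞ (fun y => fwInv (w y)) x := contDiff_fwInv.contDiffAt.comp x hw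
  exact contDiffAt_matrix_mul (contDiffAt_jacobian (g := fun _ => fw)
    ((contDiffAt_fw (by simp) hx).comp (x, fwInv (w x)) contDiffAt_snd) hz le_rfl)
    (fun i j => (R.contDiff_Qz i j).contDiffAt.comp x hz) i j

theorem contDiffAt_injectedDamping (Dhat : Matrix (Fin 2) (Fin 2) ℝ) (k : ℝ)
    (hw : ContDiffAt ℝ ∞ w x) (hx : w x 0 ≠ 0) (i j : Fin 2) :
    ContDiffAt ℝ ∞ (fun y => R.injectedDamping Dhat k (w y) i j) x := by
  have hgain : ContDiffAt ℝ ∞ (fun y => k / w y 0 ^ 2) x :=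
    contDiffAt_const.div ((contDiffAt_pi.1 hw 0).pow 2) (pow_ne_zero 2 hx)
  have hQ := R.contDiffAt_Qw hw hx
  have hrank_one := contDiffAt_matrix_mul (contDiffAt_matrix_mul
    (A := fun y => (R.Qw (w y))ᵀ) (B := fun _ => Matrix.vecMulVec (e₁ r) (e₁ r))
    (fun i j => hQ j i) fun _ _ => contDiffAt_const) hQ i j
  simp only [injectedDamping, Matrix.add_apply, Matrix.smul_apply, smul_eq_mul]
  exact contDiffAt_const.add (hgain.mul hrank_one)

end Smoothness

section ClosedLoop

variable (l : Fin (r + 2) → ℝ)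
  (Dhat : Matrix (Fin 2) (Fin 2) ℝ) (k : ℝ) (w : Fin (r + 2) → ℝ) (p : Fin 2 → ℝ)

/-- The reduced velocity `M_w⁻¹ p`, which is both `∇_p H_w` and `∇_p H_d`. -/
noncomputable def velocity : Fin 2 → ℝ := (R.Mw w)⁻¹ *ᵥ p

/-- The kinetic energy `½ pᵀ M_w⁻¹ p`, the common part of `H_w` and `H_d`. -/
noncomputable def kinetic : ℝ := 1 / 2 * (p ⬝ᵥ R.velocity w p)

theorem posDef_Mw : (R.Mw w).PosDef := R.posDef_M (R.config_mem w)

theorem kinetic_nonneg : 0 ≤ R.kinetic w p :=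
  mul_nonneg (by norm_num) (by
    simpa only [star_trivial, velocity]
      using (R.posDef_Mw w).inv.posSemidef.dotProduct_mulVec_nonneg p)

theorem velocity_eq_zero_iff {w : Fin (r + 2) → ℝ} {p : Fin 2 → ℝ} :
    R.velocity w p = 0 ↔ p = 0 :=
  ⟨fun h => Matrix.mulVec_injective_of_isUnit (R.posDef_Mw w).inv.isUnit
    (h.trans (Matrix.mulVec_zero _).symm), fun h => by rw [velocity, h, Matrix.mulVec_zero]⟩

theorem contDiff_velocity : ContDiff ℝ ∞ (Function.uncurry R.velocity) :=
  contDiff_iff_contDiffAt.2 fun x => contDiffAt_matrix_mulVec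
    (contDiffAt_matrix_inv (fun i j => ((R.contDiff_Mw i j).comp contDiff_fst).contDiffAt)
      (R.posDef_Mw x.1).det_pos.ne') contDiffAt_snd

theorem contDiff_kinetic : ContDiff ℝ ∞ (Function.uncurry R.kinetic) :=
  contDiff_iff_contDiffAt.2 fun _ => contDiffAt_const.mul
    (contDiffAt_dotProduct contDiffAt_snd R.contDiff_velocity.contDiffAt)

theorem contDiff_Hd : ContDiff ℝ ∞ (Function.uncurry (R.Hd l)) :=
  R.contDiff_kinetic.add ((contDiff_quadratic (Matrix.diagonal l)).comp contDiff_fst)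

theorem differentiableAt_kinetic_left : DifferentiableAt ℝ (fun w' => R.kinetic w' p) w :=
  (R.contDiff_kinetic.comp (contDiff_prodMk_left p)).differentiable (by simp) w

theorem grad_kinetic_right : grad (R.kinetic w) p = R.velocity w p :=
  grad_quadratic (Matrix.isHermitian_iff_isSymm.1 (R.posDef_Mw w).inv.1) p

theorem grad_Hd_right : grad (fun p' => R.Hd l w p') p = R.velocity w p :=
  (grad_add_const _ _ p).trans (R.grad_kinetic_right w p)

theorem grad_Hw_right : grad (fun p' => R.Hw w p') p = R.velocity w p :=
  (grad_add_const _ _ p).trans (R.grad_kinetic_right w p)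

theorem grad_Hd_left : grad (fun w' => R.Hd l w' p) w =
    grad (fun w' => R.kinetic w' p) w + Matrix.diagonal l *ᵥ w :=
  (grad_add (R.differentiableAt_kinetic_left w p)
    ((contDiff_quadratic (Matrix.diagonal l)).differentiable one_ne_zero w)).trans
    (congrArg _ (grad_quadratic (Matrix.diagonal_transpose l) w))

theorem grad_Hw_left : grad (fun w' => R.Hw w' p) w =
    grad (fun w' => R.kinetic w' p) w + grad R.Vw w :=
  grad_add (R.differentiableAt_kinetic_left w p) (R.contDiff_Vw.differentiable (by simp) w)

theorem closedLoop_eq : R.closedLoop l Dhat k w p =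
    (R.Qw w *ᵥ R.velocity w p,
      -((R.Qw w)ᵀ *ᵥ (grad (fun w' => R.kinetic w' p) w + Matrix.diagonal l *ᵥ w))
        + (R.Cw w p - R.Dd Dhat k w p) *ᵥ R.velocity w p) := by
  rw [closedLoop, grad_Hd_right, grad_Hd_left]

theorem openLoop_controlLaw :
    R.openLoop w p (R.controlLaw l Dhat k w p) = R.closedLoop l Dhat k w p := by
  have hG : IsUnit (R.Gw w).det := R.isUnit_det_G (R.config_mem w)
  rw [closedLoop_eq, openLoop, controlLaw, grad_Hw_right, grad_Hw_left, Matrix.mulVec_neg,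
    Matrix.mulVec_mulVec, Matrix.mul_nonsing_inv _ hG, Matrix.one_mulVec, Dd]
  simp only [Matrix.mulVec_add, Matrix.mulVec_sub, Matrix.sub_mulVec, Matrix.add_mulVec]
  congr 1
  abel

theorem contDiffOn_closedLoop :
    ContDiffOn ℝ ∞ (Function.uncurry (R.closedLoop l Dhat k)) {x | firstCoord r x ≠ 0} := by
  intro x hx
  have hΩ := R.config_mem x.1
  have hw : ContDiffAt ℝ ∞ (fun y : State r => y.1) x := contDiffAt_fst
  have hp : ContDiffAt ℝ ∞ (fun y : State r => y.2) x := contDiffAt_snd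
  have hq := R.contDiff_config.contDiffAt.comp x hw
  have hQ := R.contDiffAt_Qw hw hx
  have hv : ContDiffAt ℝ ∞ (fun y : State r => R.velocity y.1 y.2) x :=
    R.contDiff_velocity.contDiffAt
  have hforce : ContDiffAt ℝ ∞ (fun y : State r => grad (fun w' => R.kinetic w' y.2) y.1) x :=
    contDiffAt_grad (g := fun y w' => R.kinetic w' y.2) (R.contDiff_kinetic.contDiffAt.comp
      (f := fun y : State r × (Fin (r + 2) → ℝ) => (y.2, y.1.2)) (x, x.1)
      (contDiffAt_snd.prodMk (contDiffAt_snd.comp (x, x.1) contDiffAt_fst))) hw le_rfl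
  have hspring : ContDiffAt ℝ ∞ (fun y : State r => Matrix.diagonal l *ᵥ y.1) x :=
    contDiffAt_matrix_mulVec (fun _ _ => contDiffAt_const) hw
  have hgyro (i j) : ContDiffAt ℝ ∞
      (fun y : State r => (R.Cw y.1 y.2 - R.Dd Dhat k y.1 y.2) i j) x :=
    (R.contDiffAt_C hp hq hΩ i j).sub ((R.contDiffAt_D hp hq hΩ i j).add
      (R.contDiffAt_injectedDamping Dhat k hw hx i j))
  refine ContDiffAt.contDiffWithinAt ?_
  simp only [Function.uncurry_def, closedLoop_eq]
  exact (contDiffAt_matrix_mulVec hQ hv).prodMk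
    ((contDiffAt_matrix_mulVec (fun i j => hQ j i) (hforce.add hspring)).neg.add
      (contDiffAt_matrix_mulVec hgyro hv))

theorem dotProduct_injectedDamping (v : Fin 2 → ℝ) :
    v ⬝ᵥ (R.injectedDamping Dhat k w *ᵥ v) =
      v ⬝ᵥ (Dhat *ᵥ v) + k * ((R.Qw w *ᵥ v) 0 / w 0) ^ 2 := by
  have hrank_one : v ⬝ᵥ (((R.Qw w)ᵀ * Matrix.vecMulVec (e₁ r) (e₁ r) * R.Qw w) *ᵥ v) =
      (R.Qw w *ᵥ v) 0 ^ 2 := by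
    rw [← Matrix.mulVec_mulVec, ← Matrix.mulVec_mulVec, Matrix.dotProduct_mulVec,
      Matrix.vecMul_transpose, Matrix.vecMulVec_mulVec]
    simp [e₁, sq]
  rw [injectedDamping, Matrix.add_mulVec, dotProduct_add, Matrix.smul_mulVec, dotProduct_smul,
    hrank_one, smul_eq_mul, div_pow]
  ring

theorem le_dotProduct_Dd (v : Fin 2 → ℝ) :
    v ⬝ᵥ (Dhat *ᵥ v) + k * ((R.Qw w *ᵥ v) 0 / w 0) ^ 2 ≤ v ⬝ᵥ (R.Dd Dhat k w p *ᵥ v) := by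
  have hDw : 0 ≤ v ⬝ᵥ (R.Dw w p *ᵥ v) := by
    simpa only [star_trivial] using!
      (R.posSemidef_D (R.config_mem w) p).dotProduct_mulVec_nonneg v
  rw [Dd, Matrix.add_mulVec, dotProduct_add, dotProduct_injectedDamping]
  exact le_add_of_nonneg_left hDw

theorem fderiv_Hd_closedLoop :
    fderiv ℝ (Function.uncurry (R.Hd l)) (w, p) (R.closedLoop l Dhat k w p) =
      -(R.velocity w p ⬝ᵥ (R.Dd Dhat k w p *ᵥ R.velocity w p)) := by
  have hgyro : R.velocity w p ⬝ᵥ (R.Cw w p *ᵥ R.velocity w p) = 0 :=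
    dotProduct_mulVec_self_eq_zero (R.transpose_C p (R.config w)) _
  rw [closedLoop, fderiv_uncurry_apply ((R.contDiff_Hd l).differentiable (by simp) _),
    grad_Hd_right, dotProduct_add, dotProduct_neg, Matrix.dotProduct_transpose_mulVec,
    Matrix.sub_mulVec, dotProduct_sub, hgyro, zero_sub, add_neg_cancel_left]

variable {l Dhat k w p}

theorem isSingularStorage_Hd (hl : ∀ i, 0 ≤ l i) (hDhat : Dhat.PosSemidef) (hk : 0 < k) :
    IsSingularStorage (Function.uncurry (R.closedLoop l Dhat k)) (Function.uncurry (R.Hd l))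
      (firstCoord r) k where
  pos := hk
  contDiff := (R.contDiff_Hd l).of_le (by exact_mod_cast le_top)
  nonneg x := add_nonneg (R.kinetic_nonneg x.1 x.2) (mul_nonneg (by norm_num)
    ((mul_nonneg (hl 0) (sq_nonneg _)).trans (mul_sq_le_dotProduct_diagonal hl x.1 0)))
  fderiv_le := by
    rintro ⟨w, p⟩ -
    have hDhat_nonneg : 0 ≤ R.velocity w p ⬝ᵥ (Dhat *ᵥ R.velocity w p) := by
      simpa only [star_trivial] using hDhat.dotProduct_mulVec_nonneg (R.velocity w p)
    have hdamping := R.le_dotProduct_Dd Dhat k w p (R.velocity w p)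
    rw [Function.uncurry_apply_pair, fderiv_Hd_closedLoop, closedLoop_eq]
    change _ ≤ -k * ((R.Qw w *ᵥ R.velocity w p) 0 / w 0) ^ 2
    linarith

theorem momentum_eq_zero_of_fderiv_Hd_eq_zero (hDhat : Dhat.PosDef) (hk : 0 ≤ k)
    (h : fderiv ℝ (Function.uncurry (R.Hd l)) (w, p) (R.closedLoop l Dhat k w p) = 0) :
    p = 0 := by
  by_contra hp
  have hDhat_pos : 0 < R.velocity w p ⬝ᵥ (Dhat *ᵥ R.velocity w p) := by
    simpa only [star_trivial] using
      hDhat.dotProduct_mulVec_pos (R.velocity_eq_zero_iff.not.2 hp)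
  have hsingular : 0 ≤ k * ((R.Qw w *ᵥ R.velocity w p) 0 / w 0) ^ 2 := by positivity
  have hdamping := R.le_dotProduct_Dd Dhat k w p (R.velocity w p)
  rw [fderiv_Hd_closedLoop] at h
  linarith

theorem mul_sq_position_le_Hd (hl : ∀ i, 0 ≤ l i) (w : Fin (r + 2) → ℝ) (p : Fin 2 → ℝ)
    (i : Fin (r + 2)) : l i * w i ^ 2 ≤ 2 * R.Hd l w p := by
  have hkinetic := R.kinetic_nonneg w p
  have hspring := mul_sq_le_dotProduct_diagonal hl w i
  change _ ≤ 2 * (R.kinetic w p + 1 / 2 * (w ⬝ᵥ (Matrix.diagonal l *ᵥ w)))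
  linarith

theorem sq_momentum_le_Hd (hl : ∀ i, 0 ≤ l i) (w : Fin (r + 2) → ℝ) (p : Fin 2 → ℝ)
    (i : Fin 2) : p i ^ 2 ≤ R.Mw w i i * (2 * R.Hd l w p) := by
  have hspring : 0 ≤ w ⬝ᵥ (Matrix.diagonal l *ᵥ w) :=
    (mul_nonneg (hl 0) (sq_nonneg _)).trans (mul_sq_le_dotProduct_diagonal hl w 0)
  refine (sq_apply_le_diag_mul_inv (R.posDef_Mw w) p i).trans
    (mul_le_mul_of_nonneg_left ?_ (R.posDef_Mw w).posSemidef.diag_nonneg)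
  unfold Hd
  linarith

theorem isCompact_sublevel_Hd (hl : ∀ i, 0 < l i) (h : ℝ) :
    IsCompact {x : State r | R.Hd l x.1 x.2 ≤ h} := by
  have hl' (i) : 0 ≤ l i := (hl i).le
  let K : Set (Fin (r + 2) → ℝ) := univ.pi fun i => Icc (-√(2 * h / l i)) (√(2 * h / l i))
  have hK : IsCompact K := isCompact_univ_pi fun _ => isCompact_Icc
  have hMw (i : Fin 2) : ∃ B, ∀ w ∈ K, ‖R.Mw w i i‖ ≤ B :=
    hK.exists_bound_of_continuousOn (R.contDiff_Mw i i).continuous.continuousOn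
  choose B hB using hMw
  have hL : IsCompact (univ.pi fun i : Fin 2 => Icc (-√(B i * (2 * h))) (√(B i * (2 * h)))) :=
    isCompact_univ_pi fun _ => isCompact_Icc
  refine (hK.prod hL).of_isClosed_subset
    (isClosed_le (R.contDiff_Hd l).continuous continuous_const) ?_
  rintro ⟨w, p⟩ (hwp : R.Hd l w p ≤ h)
  have hw : w ∈ K := fun i _ => abs_le.1 <| Real.abs_le_sqrt <| by
    rw [le_div_iff₀' (hl i)]
    exact (R.mul_sq_position_le_Hd hl' w p i).trans (by gcongr)
  have hHd : 0 ≤ 2 * R.Hd l w p :=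
    (mul_nonneg (hl' 0) (sq_nonneg _)).trans (R.mul_sq_position_le_Hd hl' w p 0)
  refine ⟨hw, fun i _ => abs_le.1 <| Real.abs_le_sqrt ?_⟩
  have hMB : R.Mw w i i ≤ B i := (le_abs_self _).trans (hB i w hw)
  have hB_nonneg : 0 ≤ B i := (norm_nonneg _).trans (hB i w hw)
  calc p i ^ 2 ≤ R.Mw w i i * (2 * R.Hd l w p) := R.sq_momentum_le_Hd hl' w p i
    _ ≤ B i * (2 * h) := by gcongr

end ClosedLoop

section ChainedStructure


theorem fderiv_fz_injective {q : Fin (r + 2) → ℝ} (hΩ : q ∈ S.Ω) :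
    Function.Injective (fderiv ℝ R.fz q) := by
  have hfz := ((R.contDiffAt_fz hΩ).differentiableAt (by simp)).hasFDerivAt
  have hsymm := (R.contDiff_fz_symm.differentiable (by simp) (R.fz q)).hasFDerivAt
  have hleft_inv : ∀ᶠ q' in 𝓝 q, id q' = R.fz.symm (R.fz q') :=
    (S.isOpen_Ω.eventually_mem hΩ).mono fun q' hq' =>
      (R.fz.left_inv (R.source_fz.symm ▸ hq')).symm
  have hid := ((hsymm.comp q hfz).congr_of_eventuallyEq hleft_inv).unique (hasFDerivAt_id q)
  exact Function.LeftInverse.injective (g := fderiv ℝ R.fz.symm (R.fz q)) (DFunLike.congr_fun hid)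

theorem Qz_mulVec_injective (z : Fin (r + 2) → ℝ) : Function.Injective (R.Qz z).mulVec := by
  intro η η' h
  simp only [Qz, ← Matrix.mulVec_mulVec, jacobian_mulVec] at h
  exact R.Q_mulVec_injective (R.fz_symm_mem z) (R.fderiv_fz_injective (R.fz_symm_mem z) h)

theorem fderiv_fwInv_Qw_mulVec {w : Fin (r + 2) → ℝ} (hw : w 0 ≠ 0) (η : Fin 2 → ℝ) :
    fderiv ℝ fwInv w (R.Qw w *ᵥ η) = R.Qz (fwInv w) *ᵥ η := by
  rw [Qw, ← Matrix.mulVec_mulVec, jacobian_mulVec, fderiv_fwInv_fderiv_fw hw]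

theorem Qw_mulVec_zero {w : Fin (r + 2) → ℝ} (hw : w 0 ≠ 0) (η : Fin 2 → ℝ) :
    (R.Qw w *ᵥ η) 0 = (R.Qz (fwInv w) *ᵥ η) 0 := by
  rw [← R.fderiv_fwInv_Qw_mulVec hw, fderiv_fwInv_zero]

variable {R}

theorem HasChainedStructure.Qz_mulVec_succ_succ (hR : R.HasChainedStructure)
    (z : Fin (r + 2) → ℝ) (η : Fin 2 → ℝ) (j : Fin r) :
    (R.Qz z *ᵥ η) j.succ.succ = z j.castSucc.succ * (R.Qz z *ᵥ η) 0 := by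
  have hrow (ζ : Fin (r + 2) → ℝ) : (chainedAnnihilator z *ᵥ ζ) j =
      ζ j.succ.succ - z j.castSucc.succ * ζ 0 := by
    rw [sub_eq_neg_add, ← neg_mul]
    simp [Matrix.mulVec, dotProduct, chainedAnnihilator, Fin.sum_univ_succ (n := r + 1),
      Fin.succ_ne_zero]
  rw [← sub_eq_zero, ← hrow, Matrix.mulVec_mulVec, hR z, Matrix.zero_mulVec, Pi.zero_apply]

theorem HasChainedStructure.exists_Qz_mulVec_eq (hR : R.HasChainedStructure)
    (z : Fin (r + 2) → ℝ) (a b : ℝ) :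
    ∃ η : Fin 2 → ℝ, (R.Qz z *ᵥ η) 0 = a ∧ (R.Qz z *ᵥ η) 1 = b := by
  let A : Matrix (Fin 2) (Fin 2) ℝ := (R.Qz z).submatrix ![0, 1] id
  have hinj : Function.Injective A.mulVec := by
    intro η η' h
    have h0 : (R.Qz z *ᵥ η) 0 = (R.Qz z *ᵥ η') 0 := congrFun h 0
    have h1 : (R.Qz z *ᵥ η) 1 = (R.Qz z *ᵥ η') 1 := congrFun h 1
    refine R.Qz_mulVec_injective z (eq_of_coords_eq h0 h1 (funext fun j => ?_))
    rw [tail, tail, hR.Qz_mulVec_succ_succ, hR.Qz_mulVec_succ_succ, h0]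
  obtain ⟨η, hη⟩ := Matrix.mulVec_surjective_iff_isUnit.2
    (Matrix.mulVec_injective_iff_isUnit.1 hinj) ![a, b]
  exact ⟨η, congrFun hη 0, congrFun hη 1⟩

theorem HasChainedStructure.exists_Qw_mulVec_eq (hR : R.HasChainedStructure)
    {w : Fin (r + 2) → ℝ} (hw : w 0 ≠ 0) {a : ℝ} (ha : w 1 * a = 0) (b : ℝ) :
    ∃ η : Fin 2 → ℝ,
      (R.Qw w *ᵥ η) 0 = a ∧ (R.Qw w *ᵥ η) 1 = b ∧ tail (R.Qw w *ᵥ η) = 0 := by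
  obtain ⟨η, h0, h1⟩ := hR.exists_Qz_mulVec_eq (fwInv w) a
    (a * w 1 + w 0 * b + a * chainSum 0 (w 0) (tail w))
  have hfirst : (R.Qw w *ᵥ η) 0 = a := (R.Qw_mulVec_zero hw η).trans h0
  have htail : tail (R.Qw w *ᵥ η) = 0 := tail_eq_zero_of_chained hw
    (fun j => by rw [R.fderiv_fwInv_Qw_mulVec hw, hR.Qz_mulVec_succ_succ, h0, hfirst])
    (by rw [hfirst, ha])
  refine ⟨η, hfirst, mul_left_cancel₀ hw ?_, htail⟩
  rw [← R.fderiv_fwInv_Qw_mulVec hw, fderiv_fwInv_one, hfirst, htail, chainSum_zero] at h1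
  linarith

theorem HasChainedStructure.transpose_Qw_mulVec_ne_zero (hR : R.HasChainedStructure)
    {l : Fin (r + 2) → ℝ} (hl₀ : l 0 ≠ 0) (hl₁ : l 1 ≠ 0) {w : Fin (r + 2) → ℝ}
    (hw : w 0 ≠ 0) : (R.Qw w)ᵀ *ᵥ (Matrix.diagonal l *ᵥ w) ≠ 0 := by
  intro h
  have horth (a b : ℝ) (ha : w 1 * a = 0) : l 0 * w 0 * a + l 1 * w 1 * b = 0 := by
    obtain ⟨η, h0, h1, htail⟩ := hR.exists_Qw_mulVec_eq hw ha b
    have htail' (i : Fin r) : (R.Qw w *ᵥ η) i.succ.succ = 0 := congrFun htail i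
    have hsum : η ⬝ᵥ ((R.Qw w)ᵀ *ᵥ (Matrix.diagonal l *ᵥ w)) = 0 := by rw [h, dotProduct_zero]
    rw [Matrix.dotProduct_transpose_mulVec] at hsum
    simpa [dotProduct, Matrix.mulVec_diagonal, Fin.sum_univ_succ, h0, h1, htail'] using hsum
  have hw1 : w 1 = 0 := by simpa [hl₁] using horth 0 1 (mul_zero _)
  exact mul_ne_zero hl₀ hw (by simpa [hw1] using horth 1 0 (by rw [hw1, zero_mul]))

theorem HasChainedStructure.closedLoop_zero_snd_ne_zero (hR : R.HasChainedStructure)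
    {l : Fin (r + 2) → ℝ} (hl₀ : l 0 ≠ 0) (hl₁ : l 1 ≠ 0) (Dhat : Matrix (Fin 2) (Fin 2) ℝ)
    (k : ℝ) {w : Fin (r + 2) → ℝ} (hw : w 0 ≠ 0) : (R.closedLoop l Dhat k w 0).2 ≠ 0 := by
  have hkinetic : grad (fun w' => R.kinetic w' 0) w = 0 := by
    funext i
    simp [grad, kinetic]
  rw [closedLoop_eq, hkinetic, zero_add, R.velocity_eq_zero_iff.2 rfl, Matrix.mulVec_zero,
    Matrix.mulVec_zero, add_zero]
  exact neg_ne_zero.2 (hR.transpose_Qw_mulVec_ne_zero hl₀ hl₁ hw)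

end ChainedStructure

end Coordinates

end ChainedPH

theorem mainTheorem1 {r : ℕ} (S : ChainedPH.NonholonomicSystem r) (R : ChainedPH.Coordinates S)
    (hR : R.HasChainedStructure)
    (l : Fin (r + 2) → ℝ) (hl : ∀ i, 0 < l i)
    (Dhat : Matrix (Fin 2) (Fin 2) ℝ) (hDhat : Dhat.PosDef)
    (k : ℝ) (hk : 0 < k) :
    -- the control law turns the open loop into the closed loop
    (∀ (w : Fin (r + 2) → ℝ) (p : Fin 2 → ℝ), w 0 ≠ 0 →
      R.openLoop w p (R.controlLaw l Dhat k w p) = R.closedLoop l Dhat k w p) ∧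
    -- from `w₁(t₀) ≠ 0` there is exactly one solution, and it exists for all time
    (∀ (t₀ : ℝ) (x₀ : (Fin (r + 2) → ℝ) × (Fin 2 → ℝ)), x₀.1 0 ≠ 0 →
      ∃ x, R.IsSolutionOn l Dhat k (Set.Ici t₀) x ∧ x t₀ = x₀ ∧
        ∀ (T : ℝ) (y : ℝ → (Fin (r + 2) → ℝ) × (Fin 2 → ℝ)),
          R.IsSolutionOn l Dhat k (Set.Ico t₀ T) y → y t₀ = x₀ → Set.EqOn y x (Set.Ico t₀ T)) ∧
    -- every solution with `w₁(t₀) ≠ 0` keeps `w₁ ≠ 0`, and `w₁ → 0` and `z → 0`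
    (∀ (t₀ : ℝ) (x : ℝ → (Fin (r + 2) → ℝ) × (Fin 2 → ℝ)),
      R.IsSolutionOn l Dhat k (Set.Ici t₀) x → (x t₀).1 0 ≠ 0 →
        (∀ t ≥ t₀, (x t).1 0 ≠ 0) ∧
        Filter.Tendsto (fun t => (x t).1 0) Filter.atTop (nhds 0) ∧
        Filter.Tendsto (fun t => ChainedPH.fwInv (x t).1) Filter.atTop (nhds 0)) := by
  have hl' (i : Fin (r + 2)) : 0 ≤ l i := (hl i).le
  have hS := R.isSingularStorage_Hd hl' hDhat.posSemidef hk
  have hf := R.contDiffOn_closedLoop l Dhat k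
  have hf₁ := hf.of_le (m := 1) (by exact_mod_cast le_top)
  have hH := R.isCompact_sublevel_Hd hl
  refine ⟨fun w p _ => R.openLoop_controlLaw l Dhat k w p, fun t₀ x₀ hx₀ => ?_,
    fun t₀ x hx hx₀ => ?_⟩
  · obtain ⟨x, hx, rfl⟩ := hS.exists_isSolutionOff hf₁ hH t₀ hx₀
    refine ⟨x, hx, rfl, fun T y hy hyx t ht => ?_⟩
    have hlip := ChainedPH.locallyLipschitzOn_of_contDiffOn (ChainedPH.isOpen_ne_zero _) hf₁
    exact hS.eqOn_Icc hlip (ChainedPH.IsSolutionOff.mono hy (Icc_subset_Ico_right ht.2))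
      (hx.mono Icc_subset_Ici_self) (hyx ▸ hx₀) hyx ⟨ht.1, le_rfl⟩
  · have hlim := hS.tendsto_zero hf.continuousOn hH (π := ContinuousLinearMap.snd ℝ _ _)
      (fun _ _ => R.momentum_eq_zero_of_fderiv_Hd_eq_zero hDhat hk.le)
      (by rintro ⟨w, _⟩ hw rfl
          exact hR.closedLoop_zero_snd_ne_zero (hl 0).ne' (hl 1).ne' Dhat k hw) hx hx₀
    have hbdd : ∀ᶠ t in atTop,
        (x t).1 ∈ Prod.fst '' {y | R.Hd l y.1 y.2 ≤ R.Hd l (x t₀).1 (x t₀).2} :=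
      (eventually_ge_atTop t₀).mono fun t ht =>
        ⟨x t, hS.antitoneOn_energy hx hx₀ self_mem_Ici ht ht, rfl⟩
    exact ⟨fun t ht => hS.ne_zero ordConnected_Ici hx self_mem_Ici hx₀ t ht ht, hlim,
      ChainedPH.tendsto_fwInv_zero ((hH _).image continuous_fst) hbdd hlim⟩
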